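/- Let $p$ be a prime and let $K$ be a perfectoid field of residue characteristic $p$ (of characteristic $0$ or $p$), i.e. a field complete with respect to a nontrivial, non-discrete nonarchimedean absolute value $|\cdot|$ with $|p|<1$ such that the Frobenius is surjective on $K^{\circ}/p$, where $K^\circ=\{x\in K : |x|\le 1\}$. For $m\ge 0$ let the perfectoid Tate algebra $K\langle T_1^{1/p^\infty},\dots,T_m^{1/p^\infty}\rangle$ be the completion of $K[T_1^{1/p^\infty},\dots,T_m^{1/p^\infty}]$ with respect to the Gauss norm $\sum_q a_qT^q\mapsto\max_q|a_q|$. For $r=(r_1,\dots,r_l)\in\mathbb{R}_{>0}^l$ let $K_{r_1,\dots,r_l}^{\mathrm{perfd}}$ be the completion of the field $K(x_1^{1/p^\infty},\dots,x_l^{1/p^\infty})$ with respect to the multiplicative extension of the $r$-Gauss norm $\sum_q a_qx^q\mapsto\max_q|a_q|r_1^{q_1}\cdots r_l^{q_l}$ on $K[x_1^{1/p^\infty},\dots,x_l^{1/p^\infty}]$. Call $r$ free if $r_1,\dots,r_l$ are linearly independent in the multiplicatively written $\mathbb{Q}$-vector space $\mathbb{R}_{>0}/\sqrt{|K^\times|}$,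 where $\sqrt{|K^\times|}$ is the set of $t>0$ with $t^k\in|K^\times|$ for some $k\ge1$. Let $n\ge 1$. (1) For every $l\le n$ and every free $(r_1,\dots,r_l)\in(0,1]^l$, the field $K_{r_1,\dots,r_l}^{\mathrm{perfd}}$ is a quotient field of $K\langle T_1^{1/p^\infty},\dots,T_{n+2}^{1/p^\infty}\rangle$: there is a continuous, open, surjective $K$-algebra homomorphism $K\langle T_1^{1/p^\infty},\dots,T_{n+2}^{1/p^\infty}\rangle\to K_{r_1,\dots,r_l}^{\mathrm{perfd}}$. (2) For every free $(r_1,\dots,r_n)\in(0,1]^n$ there is a field $K'$ with $K\subseteq K'\subseteq K_{r_1,\dots,r_n}^{\mathrm{perfd}}$ such that $K_{r_1,\dots,r_n}^{\mathrm{perfd}}$ is a finite separable extension of $K'$ and such that $K'$, with the subspace topology, is a quotient field of $K\langle T_1^{1/p^\infty},\dots,T_{n+1}^{1/p^\infty}\rangle$: there is a continuous, open, surjective $K$-algebra homomorphism $K\langle T_1^{1/p^\infty},\dots,T_{n+1}^{1/p^\infty}\rangle\to K'$. -/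

import Mathlib

open scoped NNReal

noncomputable section

/-- A perfectoid field of residue characteristic `p`: a field, complete with respect to a
nontrivial nonarchimedean absolute value, such that `p` is topologically nilpotent, the value group
is not discrete, and the Frobenius is surjective on the ring of integers modulo `p`. -/
structure IsPerfectoidField (p : ℕ) (K : Type*) [NontriviallyNormedField K]
    [IsUltrametricDist K] : Prop where
  complete : CompleteSpace K
  norm_p_lt_one : ‖(p : K)‖ < 1
  nondiscrete : ∀ a : ℝ, a < 1 → ∃ x : K, a < ‖x‖ ∧ ‖x‖ < 1
  frobenius_surjective : ∀ x : K, ‖x‖ ≤ 1 →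
    ∃ y z : K, ‖y‖ ≤ 1 ∧ ‖z‖ ≤ 1 ∧ x = y ^ p + (p : K) * z

/-- A polyradius of length `n`. -/
abbrev Polyradius (n : ℕ) : Type := Fin n → {x : ℝ≥0 // 0 < x}

/-- The polyradius `r` is `K`-free: the classes of `r₁, …, rₙ` are linearly independent in the
`ℚ`-vector space `ℝ_{>0} / √|Kˣ|`, i.e. a monomial `r₁ ^ m₁ ⋯ rₙ ^ mₙ` with integral exponents lies
in the divisible closure of `|Kˣ|` only if all exponents vanish. -/
def IsFreePolyradius (K : Type*) [NormedField K] {n : ℕ} (r : Polyradius n) : Prop :=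
  ∀ m : Fin n → ℤ,
    (∃ k : ℕ, 0 < k ∧ ∃ c : K, c ≠ 0 ∧ (∏ i, (r i : ℝ≥0) ^ m i) ^ k = ‖c‖₊) → m = 0

/-- The additive monoid `ℤ[1/p]_{≥ 0}` of nonnegative rationals with `p`-power denominator. -/
def PExp (p : ℕ) : AddSubmonoid ℚ≥0 where
  carrier := {q | ∃ k m : ℕ, q * (p : ℚ≥0) ^ k = m}
  zero_mem' := ⟨0, 0, by simp⟩
  add_mem' := by
    rintro a b ⟨k, m, h⟩ ⟨k', m', h'⟩
    refine ⟨k + k', m * p ^ k' + m' * p ^ k, ?_⟩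
    push_cast
    rw [← h, ← h']
    ring

/-- The ring `K[x₁^{1/p^∞}, …, xₙ^{1/p^∞}]`: the monoid algebra of `ℤ[1/p]_{≥ 0}ⁿ`. -/
abbrev PerfPoly (p : ℕ) (K : Type*) [Field K] (n : ℕ) : Type _ :=
  AddMonoidAlgebra K (Fin n → PExp p)

/-- The field `K(x₁^{1/p^∞}, …, xₙ^{1/p^∞})`. -/
abbrev PerfRatFunc (p : ℕ) (K : Type*) [Field K] (n : ℕ) : Type _ :=
  FractionRing (PerfPoly p K n)

section Gauss

variable {p : ℕ} {n : ℕ}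

/-- `r ^ q = r₁ ^ q₁ ⋯ rₙ ^ qₙ`. -/
def monomialNorm (r : Polyradius n) (q : Fin n → PExp p) : ℝ≥0 :=
  ∏ i, (r i : ℝ≥0) ^ (((q i : ℚ≥0) : ℝ))

lemma monomialNorm_pos (r : Polyradius n) (q : Fin n → PExp p) : 0 < monomialNorm r q :=
  Finset.prod_pos fun i _ => NNReal.rpow_pos (r i).2

lemma monomialNorm_zero (r : Polyradius n) : monomialNorm r (0 : Fin n → PExp p) = 1 := by
  simp [monomialNorm]

lemma monomialNorm_add (r : Polyradius n) (q q' : Fin n → PExp p) :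
    monomialNorm r (q + q') = monomialNorm r q * monomialNorm r q' := by
  unfold monomialNorm
  rw [← Finset.prod_mul_distrib]
  refine Finset.prod_congr rfl fun i _ => ?_
  rw [← NNReal.rpow_add (r i).2.ne']
  simp

variable {K : Type*} [NormedField K]

/-- The `r`-Gauss norm: the maximum over the monomials of `f` of `|a_q| r ^ q`. -/
def gaussNormFun (r : Polyradius n) (f : PerfPoly p K n) : ℝ≥0 :=
  f.coeff.support.sup fun q => ‖f.coeff q‖₊ * monomialNorm r q

lemma le_gaussNormFun (r : Polyradius n) (f : PerfPoly p K n) (q : Fin n → PExp p) :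
    ‖f.coeff q‖₊ * monomialNorm r q ≤ gaussNormFun r f := by
  by_cases h : q ∈ f.coeff.support
  · exact Finset.le_sup (f := fun q => ‖f.coeff q‖₊ * monomialNorm r q) h
  · simp [Finsupp.notMem_support_iff.mp h]

lemma gaussNormFun_le_iff (r : Polyradius n) (f : PerfPoly p K n) (c : ℝ≥0) :
    gaussNormFun r f ≤ c ↔ ∀ q, ‖f.coeff q‖₊ * monomialNorm r q ≤ c :=
  ⟨fun h q => (le_gaussNormFun r f q).trans h, fun h => Finset.sup_le fun q _ => h q⟩

lemma gaussNormFun_single (r : Polyradius n) (q : Fin n → PExp p) (a : K) :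
    gaussNormFun r (AddMonoidAlgebra.single q a) = ‖a‖₊ * monomialNorm r q := by
  refine le_antisymm ((gaussNormFun_le_iff _ _ _).2 fun q' => ?_) ?_
  · classical
    rw [AddMonoidAlgebra.coeff_single, Finsupp.single_apply]
    split_ifs with h
    · rw [h]
    · simp
  · simpa using le_gaussNormFun r (AddMonoidAlgebra.single q a) q

lemma gaussNormFun_eq_zero (r : Polyradius n) (f : PerfPoly p K n) :
    gaussNormFun r f = 0 ↔ f = 0 := by
  constructor
  · intro h
    rw [← AddMonoidAlgebra.coeff_eq_zero]
    ext q
    have := (gaussNormFun_le_iff r f 0).1 h.le q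
    simpa [(monomialNorm_pos r q).ne'] using this
  · rintro rfl
    simp [gaussNormFun]

/-- Split off the part of `f` consisting of the monomials of maximal norm. -/
lemma exists_top_part (r : Polyradius n) {f : PerfPoly p K n} (hf : f ≠ 0) :
    ∃ f₁ f₂ : PerfPoly p K n, f = f₁ + f₂ ∧ f₁ ≠ 0 ∧ gaussNormFun r f₂ < gaussNormFun r f ∧
      ∀ q ∈ f₁.coeff.support, ‖f₁.coeff q‖₊ * monomialNorm r q = gaussNormFun r f := by
  classical
  let P : (Fin n → PExp p) → Prop := fun q => ‖f.coeff q‖₊ * monomialNorm r q = gaussNormFun r f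
  refine ⟨.ofCoeff (f.coeff.filter P), .ofCoeff (f.coeff.filter fun q => ¬ P q), ?_, ?_, ?_, ?_⟩
  · rw [← AddMonoidAlgebra.ofCoeff_add, Finsupp.filter_add_filter_not]
  · have hne : f.coeff.support.Nonempty := by
      rwa [Finsupp.support_nonempty_iff, ne_eq, AddMonoidAlgebra.coeff_eq_zero]
    obtain ⟨q, hq, h⟩ := Finset.exists_mem_eq_sup _ hne
      (fun q => ‖f.coeff q‖₊ * monomialNorm r q)
    intro h0
    have h1 : (f.coeff.filter P) q = 0 := by
      rw [AddMonoidAlgebra.ofCoeff_eq_zero.1 h0]; rfl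
    rw [Finsupp.filter_apply_pos P _ h.symm] at h1
    exact Finsupp.mem_support_iff.1 hq h1
  · have hpos : 0 < gaussNormFun r f := by
      rw [pos_iff_ne_zero]; exact fun h => hf ((gaussNormFun_eq_zero r f).1 h)
    refine (Finset.sup_lt_iff hpos).2 fun q hq => ?_
    have hq' := Finsupp.mem_support_iff.1 hq
    simp only [Finsupp.filter_apply] at hq' ⊢
    split_ifs at hq' ⊢ with h
    · exact absurd rfl hq'
    · exact lt_of_le_of_ne (le_gaussNormFun r f q) h
  · intro q hq
    have hq' := Finsupp.mem_support_iff.1 hq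
    simp only [Finsupp.filter_apply] at hq' ⊢
    split_ifs with h
    · exact h
    · simp [h] at hq'

variable [IsUltrametricDist K]

lemma gaussNormFun_add (r : Polyradius n) (f g : PerfPoly p K n) :
    gaussNormFun r (f + g) ≤ max (gaussNormFun r f) (gaussNormFun r g) := by
  refine (gaussNormFun_le_iff _ _ _).2 fun q => ?_
  rw [AddMonoidAlgebra.coeff_add, Finsupp.add_apply]
  have h := IsUltrametricDist.nnnorm_add_le_max (f.coeff q) (g.coeff q)
  calc _ ≤ max ‖f.coeff q‖₊ ‖g.coeff q‖₊ * monomialNorm r q := by gcongr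
    _ = max (‖f.coeff q‖₊ * monomialNorm r q) (‖g.coeff q‖₊ * monomialNorm r q) :=
      max_mul_of_nonneg _ _ (zero_le)
    _ ≤ _ := max_le_max (le_gaussNormFun r f q) (le_gaussNormFun r g q)

lemma gaussNormFun_mul_le (r : Polyradius n) (f g : PerfPoly p K n) :
    gaussNormFun r (f * g) ≤ gaussNormFun r f * gaussNormFun r g := by
  classical
  refine (gaussNormFun_le_iff _ _ _).2 fun q => ?_
  rw [AddMonoidAlgebra.coeff_mul, ← le_div_iff₀ (monomialNorm_pos r q)]
  refine IsUltrametricDist.nnnorm_sum_le_of_forall_le fun a _ => ?_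
  refine IsUltrametricDist.nnnorm_sum_le_of_forall_le fun b _ => ?_
  dsimp only
  split_ifs with h
  · rw [le_div_iff₀ (monomialNorm_pos r q), ← h, monomialNorm_add, nnnorm_mul, mul_mul_mul_comm]
    exact mul_le_mul' (le_gaussNormFun r f a) (le_gaussNormFun r g b)
  · simp

lemma gaussNormFun_mul (r : Polyradius n) (f g : PerfPoly p K n) :
    gaussNormFun r (f * g) = gaussNormFun r f * gaussNormFun r g := by
  classical
  refine le_antisymm (gaussNormFun_mul_le r f g) ?_
  by_cases hf : f = 0
  · rw [(gaussNormFun_eq_zero r f).2 hf, zero_mul]; exact zero_le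
  by_cases hg : g = 0
  · rw [(gaussNormFun_eq_zero r g).2 hg, mul_zero]; exact zero_le
  obtain ⟨f₁, f₂, ef, nf, lf, tf⟩ := exists_top_part r hf
  obtain ⟨g₁, g₂, eg, ng, lg, tg⟩ := exists_top_part r hg
  have hFpos : 0 < gaussNormFun r f := lt_of_le_of_lt zero_le lf
  have hGpos : 0 < gaussNormFun r g := lt_of_le_of_lt zero_le lg
  have nf' : f₁.coeff.support.Nonempty := by
    rwa [Finsupp.support_nonempty_iff, ne_eq, AddMonoidAlgebra.coeff_eq_zero]
  have ng' : g₁.coeff.support.Nonempty := by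
    rwa [Finsupp.support_nonempty_iff, ne_eq, AddMonoidAlgebra.coeff_eq_zero]
  obtain ⟨a, ha, b, hb, hu⟩ := UniqueSums.uniqueAdd_of_nonempty nf' ng'
  have hlow : gaussNormFun r (f₁ * g₂ + f₂ * g) < gaussNormFun r f * gaussNormFun r g := by
    have hf₁ : gaussNormFun r f₁ ≤ gaussNormFun r f := Finset.sup_le fun q hq => (tf q hq).le
    refine lt_of_le_of_lt (gaussNormFun_add r _ _) (max_lt ?_ ?_)
    · refine lt_of_le_of_lt (gaussNormFun_mul_le r _ _) ?_
      exact lt_of_le_of_lt (mul_le_mul_left hf₁ _) (mul_lt_mul_of_pos_left lg hFpos)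
    · refine lt_of_le_of_lt (gaussNormFun_mul_le r _ _) ?_
      exact mul_lt_mul_of_pos_right lf hGpos
  have hprod : f₁ * g₁ = f * g + -(f₁ * g₂ + f₂ * g) := by
    have h1 : g₁ = g - g₂ := by rw [eg]; ring
    have h2 : f₂ = f - f₁ := by rw [ef]; ring
    rw [h1, h2]; ring
  have hneg : gaussNormFun r (-(f₁ * g₂ + f₂ * g)) = gaussNormFun r (f₁ * g₂ + f₂ * g) := by
    simp only [gaussNormFun, AddMonoidAlgebra.coeff_neg, Finsupp.support_neg, Finsupp.neg_apply,
      nnnorm_neg]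
  have htop : gaussNormFun r f * gaussNormFun r g ≤ gaussNormFun r (f₁ * g₁) := by
    have := le_gaussNormFun r (f₁ * g₁) (a + b)
    rwa [AddMonoidAlgebra.coeff_mul_add_of_uniqueAdd hu, monomialNorm_add, nnnorm_mul,
      mul_mul_mul_comm, tf a ha, tg b hb] at this
  rw [hprod] at htop
  have := htop.trans (gaussNormFun_add r _ _)
  rw [hneg] at this
  rcases le_max_iff.1 this with h | h
  · exact h
  · exact absurd h (not_le.2 hlow)

variable (p K) in
/-- The `r`-Gauss norm on `K[x₁^{1/p^∞}, …, xₙ^{1/p^∞}]`, as a valuation. -/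
def gaussValuation (r : Polyradius n) : Valuation (PerfPoly p K n) ℝ≥0 where
  toFun := gaussNormFun r
  map_zero' := (gaussNormFun_eq_zero r 0).2 rfl
  map_one' := by
    rw [AddMonoidAlgebra.one_def, gaussNormFun_single]; simp [monomialNorm_zero]
  map_mul' := gaussNormFun_mul r
  map_add_le_max' := gaussNormFun_add r

lemma gaussValuation_le_primeCompl (r : Polyradius n) :
    nonZeroDivisors (PerfPoly p K n) ≤ (gaussValuation p K r).supp.primeCompl := fun f hf h =>
  nonZeroDivisors.ne_zero hf ((gaussNormFun_eq_zero r f).1 ((Valuation.mem_supp_iff _ _).1 h))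

variable (p K) in
/-- The canonical extension of the `r`-Gauss norm to `K(x₁^{1/p^∞}, …, xₙ^{1/p^∞})`. -/
def gaussValuationFrac (r : Polyradius n) : Valuation (PerfRatFunc p K n) ℝ≥0 :=
  (gaussValuation p K r).extendToLocalization (gaussValuation_le_primeCompl r) _

variable (p K) in
/-- The `r`-Gauss norm on `K[x₁^{1/p^∞}, …, xₙ^{1/p^∞}]`, as a real absolute value. -/
def gaussAbs (r : Polyradius n) : AbsoluteValue (PerfPoly p K n) ℝ where
  toFun f := (gaussValuation p K r f : ℝ)
  map_mul' f g := by simp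
  nonneg' f := NNReal.coe_nonneg _
  eq_zero' f := by
    rw [NNReal.coe_eq_zero]; exact gaussNormFun_eq_zero r f
  add_le' f g := by
    have h := (gaussValuation p K r).map_add f g
    exact_mod_cast h.trans (max_le_add_of_nonneg zero_le zero_le)

variable (p K) in
/-- The `r`-Gauss norm on `K(x₁^{1/p^∞}, …, xₙ^{1/p^∞})`, as a real absolute value. -/
def gaussAbsFrac (r : Polyradius n) : AbsoluteValue (PerfRatFunc p K n) ℝ where
  toFun f := (gaussValuationFrac p K r f : ℝ)
  map_mul' f g := by simp
  nonneg' f := NNReal.coe_nonneg _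
  eq_zero' f := by
    rw [NNReal.coe_eq_zero]; exact Valuation.zero_iff _
  add_le' f g := by
    have h := (gaussValuationFrac p K r).map_add f g
    exact_mod_cast h.trans (max_le_add_of_nonneg zero_le zero_le)

instance (r : Polyradius n) : UniformContinuousConstSMul K (WithAbs (gaussAbs p K r)) where
  uniformContinuous_const_smul a := by
    simp_rw [Algebra.smul_def]
    exact (Ring.uniformContinuousConstSMul _).uniformContinuous_const_smul _

end Gauss

/-- The perfectoid Tate algebra `K⟨X₁^{1/p^∞}, …, Xₙ^{1/p^∞}⟩` in `n` variables: the completion of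
`K[X₁^{1/p^∞}, …, Xₙ^{1/p^∞}]` with respect to the `(1, …, 1)`-Gauss norm. -/
abbrev PerfdTateAlgebra (p : ℕ) (K : Type*) [NormedField K] [IsUltrametricDist K] (n : ℕ) :
    Type _ :=
  UniformSpace.Completion (WithAbs (gaussAbs p K (fun _ => ⟨1, one_pos⟩ : Polyradius n)))

/-- The field `K_{r₁, …, rₙ}^perfd`: the completion of `K(x₁^{1/p^∞}, …, xₙ^{1/p^∞})` with respect
to the `(r₁, …, rₙ)`-Gauss norm. -/
abbrev PerfdGaussField (p : ℕ) (K : Type*) [NormedField K] [IsUltrametricDist K] {n : ℕ}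
    (r : Polyradius n) : Type _ :=
  (gaussAbsFrac p K r).Completion

end

noncomputable section

/-! One variable more than `l` suffices, so both statements follow from one construction; in (2) the
field `K'` can be the whole of `K_r^perfd`.

Write `P = x₁ ⋯ x_l`, with roots `P m`, and let `π` be a root system in `K` with `‖π 0‖ = ρ < 1` and
`‖p‖ ≤ ρ ^ 4`. Send the first `l` variables to the `x_i` and every further variable to `w = π ^ M *
E / P`, with compatible roots `w m`. Here `M` makes `w` integral, and `E` is a root system of
principal units encoding all Laurent monomials. Enumerate these, scaled by powers of `π` to have
norm in `(ρ ^ 3, ρ ^ 2]`, as root systems `τ j`, and arrange that `E k` is `1 + ∑ τ j (k - κ j)`,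
summed over `κ j ≤ k`, up to `ρ ^ 4` (`exists_isRootSystem_one_add_sum`). Such an `E` exists because
Frobenius is additive modulo `p`.

At level `κ j` the new summand is `τ j 0` itself, while the earlier ones are high roots `τ i (κ j -
κ i)`. If `κ` grows fast enough, these roots have fractional exponents so small that they are
approximated by images of elements of bounded Gauss norm (`exists_approx_monomial`): `1 / P m` comes
from `w m` at the cost of `π m ^ (-M)`, and `E m` is inverted by a truncated series in `E m - 1`.
Subtracting them from `E (κ j) - 1` approximates every `τ j 0` with one uniform bound
(`exists_approx_of_root_systems`).

The error `ρ ^ 4` against the norm `> ρ ^ 3` is a relative error `ρ`. Since the Gauss norm is the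
maximum over monomials, this passes to Laurent polynomials. Freeness makes these dense
(`IsFreePolyradius.exists_laurent_approx`), since each denominator is dominated by one monomial.
Successive approximation (`isOpenQuotientMap_of_approx`) then gives surjectivity and openness. -/

/-- A compatible system of `p`-power roots: `a (k + 1) ^ p = a k` for all `k`. -/
def IsRootSystem (p : ℕ) {M : Type*} [Monoid M] (a : ℕ → M) : Prop :=
  ∀ k, a (k + 1) ^ p = a k

/-! ### Compatible systems of `p`-power roots -/

namespace IsRootSystem

section Monoid

variable {p : ℕ} {M : Type*} [CommMonoid M] {a b : ℕ → M}

lemma pow_pow (ha : IsRootSystem p a) (k m : ℕ) : a (k + m) ^ p ^ m = a k := by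
  induction m with
  | zero => simp
  | succ m ih => rw [pow_succ', pow_mul, ← add_assoc, ha, ih]

lemma pow_pow_zero (ha : IsRootSystem p a) (m : ℕ) : a m ^ p ^ m = a 0 := by
  simpa using ha.pow_pow 0 m

lemma mul (ha : IsRootSystem p a) (hb : IsRootSystem p b) : IsRootSystem p (a * b) := fun k => by
  simp [mul_pow, ha k, hb k]

lemma pow (ha : IsRootSystem p a) (n : ℕ) : IsRootSystem p (a ^ n) := fun k => by
  simp only [Pi.pow_apply]
  rw [← pow_mul, mul_comm, pow_mul, ha]

lemma map {N F : Type*} [CommMonoid N] [FunLike F M N] [MonoidHomClass F M N] (f : F)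
    (ha : IsRootSystem p a) : IsRootSystem p (fun k => f (a k)) := fun k => by
  simp only [← map_pow, ha k]

end Monoid

section Field

variable {p : ℕ} {F : Type*} [Field F] {a : ℕ → F}

lemma inv (ha : IsRootSystem p a) : IsRootSystem p a⁻¹ := fun k => by
  simp [inv_pow, ha k]

lemma zpow (ha : IsRootSystem p a) (n : ℤ) : IsRootSystem p (fun k => a k ^ n) := fun k => by
  dsimp only
  rw [← zpow_natCast, ← zpow_mul, mul_comm, zpow_mul, zpow_natCast, ha]

end Field

section Normed

variable {p : ℕ} {F : Type*} [NormedField F] {a : ℕ → F}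

lemma nnnorm_pow (ha : IsRootSystem p a) (m : ℕ) : ‖a m‖₊ ^ p ^ m = ‖a 0‖₊ := by
  rw [← _root_.nnnorm_pow, ha.pow_pow_zero]

lemma nnnorm_le_one [Fact p.Prime] (ha : IsRootSystem p a) (h : ‖a 0‖₊ ≤ 1) (m : ℕ) :
    ‖a m‖₊ ≤ 1 := by
  rw [← ha.nnnorm_pow m] at h
  exact (pow_le_one_iff (pow_ne_zero _ (Fact.out : p.Prime).ne_zero)).1 h

end Normed

end IsRootSystem

/-! ### Approximate additivity of Frobenius and lifting of approximate root systems -/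

section Frobenius

variable {p : ℕ} [hp : Fact p.Prime] {F : Type*} [NormedField F] [IsUltrametricDist F]

/-- Every mixed term of the binomial expansion is divisible by `p * x * y`. -/
lemma nnnorm_add_pow_sub_le {x y : F} {c : ℝ≥0} (hx : ‖x‖₊ ≤ c) (hc : c ≤ 1) (hy : ‖y‖₊ ≤ 1) :
    ‖(x + y) ^ p - (x ^ p + y ^ p)‖₊ ≤ ‖(p : F)‖₊ * c := by
  rw [add_pow_prime_eq hp.out, add_sub_cancel_left, nnnorm_mul, nnnorm_mul, nnnorm_mul]
  have h : ‖∑ k ∈ Finset.Ioo 0 p, x ^ (k - 1) * y ^ (p - k - 1) * ((p.choose k / p : ℕ) : F)‖₊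
      ≤ 1 := by
    refine IsUltrametricDist.nnnorm_sum_le_of_forall_le fun k _ => ?_
    rw [nnnorm_mul, nnnorm_mul, _root_.nnnorm_pow, _root_.nnnorm_pow]
    exact mul_le_one' (mul_le_one' (pow_le_one' (hx.trans hc) _) (pow_le_one' hy _))
      (IsUltrametricDist.nnnorm_natCast_le_one F _)
  calc _ ≤ ‖(p : F)‖₊ * c * 1 * 1 := by gcongr
    _ = _ := by rw [mul_one, mul_one]

lemma nnnorm_sum_pow_sub_le {ι : Type*} (s : Finset ι) (f : ι → F) (hf : ∀ i ∈ s, ‖f i‖₊ ≤ 1) :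
    ‖(∑ i ∈ s, f i) ^ p - ∑ i ∈ s, f i ^ p‖₊ ≤ ‖(p : F)‖₊ := by
  classical
  induction s using Finset.induction_on with
  | empty => simp [hp.out.ne_zero]
  | insert a s ha ih =>
    rw [Finset.sum_insert ha, Finset.sum_insert ha]
    have h1 := nnnorm_add_pow_sub_le (p := p) (y := ∑ i ∈ s, f i)
      (hf a (Finset.mem_insert_self _ _)) le_rfl
      (IsUltrametricDist.nnnorm_sum_le_of_forall_le
        (fun i hi => hf i (Finset.mem_insert_of_mem hi)))
    have h2 := ih fun i hi => hf i (Finset.mem_insert_of_mem hi)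
    have : (f a + ∑ i ∈ s, f i) ^ p - (f a ^ p + ∑ i ∈ s, f i ^ p) =
      ((f a + ∑ i ∈ s, f i) ^ p - (f a ^ p + (∑ i ∈ s, f i) ^ p)) +
      ((∑ i ∈ s, f i) ^ p - ∑ i ∈ s, f i ^ p) := by ring
    rw [this]
    refine (IsUltrametricDist.nnnorm_add_le_max _ _).trans (max_le ?_ h2)
    simpa using h1

/-- Taking `p`-th powers contracts distances by the factor `d`. Expand `x = (x - y) + y`: the mixed
terms gain `‖p‖ ≤ d`, and `(x - y) ^ p` gains at least one further factor `c ≤ d` because `p ≥ 2`.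
-/
lemma nnnorm_pow_sub_pow_le {x y : F} {c d : ℝ≥0} (hp' : ‖(p : F)‖₊ ≤ d) (hxy : ‖x - y‖₊ ≤ c)
    (hcd : c ≤ d) (hd : d ≤ 1) (hy : ‖y‖₊ ≤ 1) : ‖x ^ p - y ^ p‖₊ ≤ d * c := by
  have h1 := nnnorm_add_pow_sub_le (p := p) hxy (hcd.trans hd) hy
  rw [sub_add_cancel] at h1
  have : x ^ p - y ^ p = (x ^ p - ((x - y) ^ p + y ^ p)) + (x - y) ^ p := by ring
  rw [this]
  refine (IsUltrametricDist.nnnorm_add_le_max _ _).trans (max_le (h1.trans (by gcongr)) ?_)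
  rw [_root_.nnnorm_pow]
  calc ‖x - y‖₊ ^ p ≤ c ^ p := by gcongr
    _ ≤ c ^ 2 := pow_le_pow_of_le_one zero_le (hcd.trans hd) hp.out.two_le
    _ ≤ d * c := by rw [sq]; gcongr

lemma nnnorm_pow_pow_sub_le {x y : F} {d : ℝ≥0} (hp' : ‖(p : F)‖₊ ≤ d) (hxy : ‖x - y‖₊ ≤ d)
    (hd : d ≤ 1) (hy : ‖y‖₊ ≤ 1) (m : ℕ) : ‖x ^ p ^ m - y ^ p ^ m‖₊ ≤ d * d ^ m := by
  induction m with
  | zero => simpa using hxy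
  | succ m ih =>
    have := nnnorm_pow_sub_pow_le hp' ih (mul_le_of_le_one_right zero_le (pow_le_one' hd m))
      hd (y := y ^ p ^ m) (by rw [_root_.nnnorm_pow]; exact pow_le_one' hy _)
    rw [← pow_mul, ← pow_mul, ← pow_succ] at this
    rw [pow_succ' d]
    exact this

/-- A sequence which is a system of `p`-power roots up to an error `d < 1` is approximated by
an exact system of `p`-power roots. -/
lemma exists_isRootSystem_of_approx [CompleteSpace F] {d : ℝ≥0} (hd : d < 1)
    (hp' : ‖(p : F)‖₊ ≤ d) (y : ℕ → F) (hy : ∀ k, ‖y k‖₊ ≤ 1)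
    (hyp : ∀ k, ‖y (k + 1) ^ p - y k‖₊ ≤ d) :
    ∃ e : ℕ → F, IsRootSystem p e ∧ ∀ k, ‖e k - y k‖₊ ≤ d := by
  -- The exact roots are the limits of `y (k + m) ^ p ^ m` as `m` grows: each power contracts the
  -- initial error `d` once more.
  have step : ∀ k m, ‖y (k + (m + 1)) ^ p ^ (m + 1) - y (k + m) ^ p ^ m‖₊ ≤ d * d ^ m := by
    intro k m
    rw [pow_succ' p, pow_mul, ← add_assoc]
    exact nnnorm_pow_pow_sub_le hp' (hyp _) hd.le (hy _) m
  have cau : ∀ k, CauchySeq fun m => y (k + m) ^ p ^ m := by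
    intro k
    refine cauchySeq_of_le_geometric (d : ℝ) d (by exact_mod_cast hd) fun m => ?_
    rw [dist_comm, dist_eq_norm]
    exact_mod_cast step k m
  choose e he using fun k => cauchySeq_tendsto_of_complete (cau k)
  refine ⟨e, fun k => ?_, fun k => ?_⟩
  · have h1 := ((he (k + 1)).pow p)
    have h2 := (Filter.tendsto_add_atTop_iff_nat 1).2 (he k)
    refine tendsto_nhds_unique h1 (h2.congr fun m => ?_)
    rw [← pow_mul, ← pow_succ, add_assoc, add_comm 1 m]
  · have h1 : ∀ m, ‖y (k + m) ^ p ^ m - y k‖₊ ≤ d := by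
      intro m
      induction m with
      | zero => simp
      | succ m ih =>
        rw [← sub_add_sub_cancel _ (y (k + m) ^ p ^ m)]
        refine (IsUltrametricDist.nnnorm_add_le_max _ _).trans (max_le ((step k m).trans ?_) ih)
        exact mul_le_of_le_one_right zero_le (pow_le_one' hd.le m)
    exact le_of_tendsto (((he k).sub_const (y k)).nnnorm) (Filter.Eventually.of_forall h1)

/-- Given root systems `τ j` and shifts `κ j`, there is a root system whose `k`-th member is close
to `1 + ∑ τ j (k - κ j)`, the sum being over all `j` with `κ j ≤ k`. -/
lemma exists_isRootSystem_one_add_sum [CompleteSpace F] {ρ : ℝ≥0} (hρ : ρ < 1)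
    (hp' : ‖(p : F)‖₊ ≤ ρ ^ 4) {τ : ℕ → ℕ → F} (hτ : ∀ j, IsRootSystem p (τ j))
    (hτ0 : ∀ j, ‖τ j 0‖₊ ≤ ρ ^ 2) {κ : ℕ → ℕ} (hκ : StrictMono κ) :
    ∃ e : ℕ → F, IsRootSystem p e ∧ (∀ k, ‖e k - 1‖₊ ^ p ^ k ≤ ρ ^ 2) ∧
      ∀ j, ‖e (κ j) - 1 - ∑ i ∈ Finset.range j, τ i (κ j - κ i) - τ j 0‖₊ ≤ ρ ^ 4 := by
  have hρ4 : ρ ^ 4 < 1 := pow_lt_one₀ zero_le hρ (by norm_num)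
  have hρ2 : ρ ^ 2 ≤ 1 := pow_le_one' hρ.le 2
  have hτ1 : ∀ j m, ‖τ j m‖₊ ≤ 1 := fun j m => (hτ j).nnnorm_le_one ((hτ0 j).trans hρ2) m
  -- The cut at `k + 1` loses nothing, since `j ≤ κ j`.
  let S : ℕ → Finset ℕ := fun k => (Finset.range (k + 1)).filter fun j => κ j ≤ k
  have hS : ∀ k j, j ∈ S k ↔ κ j ≤ k := by
    intro k j
    simp only [S, Finset.mem_filter, Finset.mem_range, and_iff_right_iff_imp]
    intro h
    have := hκ.id_le j
    simp only [id] at this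
    omega
  let s : ℕ → F := fun k => ∑ j ∈ S k, τ j (k - κ j)
  have hs1 : ∀ k, ‖s k‖₊ ≤ 1 := fun k =>
    IsUltrametricDist.nnnorm_sum_le_of_forall_le fun j _ => hτ1 _ _
  have hone : ‖(1 : F)‖₊ ≤ 1 := by simp
  -- Modulo `p` the power distributes over the sum, and each old root drops one level. The only new
  -- summands have `κ j = k + 1` and contribute `τ j 0 ^ p`, of norm at most `ρ ^ (2 * p) ≤ ρ ^ 4`.
  have hstep : ∀ k, ‖(1 + s (k + 1)) ^ p - (1 + s k)‖₊ ≤ ρ ^ 4 := by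
    intro k
    have e1 := nnnorm_add_pow_sub_le (p := p) hone le_rfl (hs1 (k + 1))
    have e2 := nnnorm_sum_pow_sub_le (p := p) (S (k + 1)) (fun j => τ j (k + 1 - κ j))
      (fun j _ => hτ1 _ _)
    have hsub : S k ⊆ S (k + 1) := fun j hj => (hS _ _).2 (((hS _ _).1 hj).trans (Nat.le_succ k))
    have e3 : ‖∑ j ∈ S (k + 1), τ j (k + 1 - κ j) ^ p - s k‖₊ ≤ ρ ^ 4 := by
      rw [← Finset.sum_sdiff hsub]
      have : ∑ j ∈ S k, τ j (k + 1 - κ j) ^ p = s k := by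
        refine Finset.sum_congr rfl fun j hj => ?_
        have := (hS _ _).1 hj
        rw [show k + 1 - κ j = k - κ j + 1 by omega, hτ j]
      rw [this, add_sub_cancel_right]
      refine IsUltrametricDist.nnnorm_sum_le_of_forall_le fun j hj => ?_
      rw [Finset.mem_sdiff, hS, hS] at hj
      rw [show k + 1 - κ j = 0 by omega, nnnorm_pow]
      calc ‖τ j 0‖₊ ^ p ≤ (ρ ^ 2) ^ p := by gcongr; exact hτ0 j
        _ ≤ (ρ ^ 2) ^ 2 := pow_le_pow_of_le_one zero_le hρ2 hp.out.two_le
        _ = ρ ^ 4 := by rw [← pow_mul]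
    have : (1 + s (k + 1)) ^ p - (1 + s k) =
        ((1 + s (k + 1)) ^ p - (1 ^ p + s (k + 1) ^ p)) +
        ((s (k + 1) ^ p - ∑ j ∈ S (k + 1), τ j (k + 1 - κ j) ^ p) +
        (∑ j ∈ S (k + 1), τ j (k + 1 - κ j) ^ p - s k)) := by ring
    rw [this]
    refine (IsUltrametricDist.nnnorm_add_le_max _ _).trans (max_le ?_
      ((IsUltrametricDist.nnnorm_add_le_max _ _).trans (max_le (e2.trans hp') e3)))
    exact e1.trans (by simpa using hp')
  obtain ⟨e, he, hes⟩ := exists_isRootSystem_of_approx hρ4 hp' (fun k => 1 + s k)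
    (fun k => (IsUltrametricDist.nnnorm_add_le_max _ _).trans (max_le hone (hs1 k))) hstep
  refine ⟨e, he, fun k => ?_, fun j => ?_⟩
  · have h0 : e k - 1 = (e k - (1 + s k)) + s k := by ring
    have hpk : p ^ k ≠ 0 := pow_ne_zero _ hp.out.ne_zero
    have h1 : ‖e k - (1 + s k)‖₊ ^ p ^ k ≤ ρ ^ 2 := by
      calc _ ≤ (ρ ^ 4) ^ p ^ k := by gcongr; exact hes k
        _ ≤ ρ ^ 4 := pow_le_of_le_one zero_le hρ4.le hpk
        _ ≤ ρ ^ 2 := pow_le_pow_of_le_one zero_le hρ.le (by norm_num)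
    -- A summand of maximal norm decides; its `p ^ k`-th power is `τ j 0 ^ p ^ κ j`.
    have h2 : ‖s k‖₊ ^ p ^ k ≤ ρ ^ 2 := by
      by_cases hne : (S k).Nonempty
      · obtain ⟨j, hj, h⟩ := IsUltrametricDist.exists_norm_finsetSum_le_of_nonempty hne
          (fun j => τ j (k - κ j))
        have h' : ‖s k‖₊ ≤ ‖τ j (k - κ j)‖₊ := h
        have hj' := (hS _ _).1 hj
        calc ‖s k‖₊ ^ p ^ k ≤ ‖τ j (k - κ j)‖₊ ^ p ^ k := by gcongr
          _ = (‖τ j (k - κ j)‖₊ ^ p ^ (k - κ j)) ^ p ^ κ j := by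
            rw [← pow_mul, ← pow_add, Nat.sub_add_cancel hj']
          _ = ‖τ j 0‖₊ ^ p ^ κ j := by rw [(hτ j).nnnorm_pow]
          _ ≤ (ρ ^ 2) ^ p ^ κ j := by gcongr; exact hτ0 j
          _ ≤ ρ ^ 2 := pow_le_of_le_one zero_le hρ2 (pow_ne_zero _ hp.out.ne_zero)
      · rw [Finset.not_nonempty_iff_eq_empty] at hne
        have : s k = 0 := by simp [s, hne]
        rw [this, nnnorm_zero, zero_pow hpk]
        exact zero_le
    rw [h0]
    rcases le_max_iff.1 (IsUltrametricDist.nnnorm_add_le_max (e k - (1 + s k)) (s k)) with h | h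
    · exact (pow_le_pow_left' h _).trans h1
    · exact (pow_le_pow_left' h _).trans h2
  · have hSj : S (κ j) = Finset.range (j + 1) := by
      ext i
      rw [hS, hκ.le_iff_le, Finset.mem_range, Nat.lt_succ_iff]
    have : s (κ j) = ∑ i ∈ Finset.range j, τ i (κ j - κ i) + τ j 0 := by
      simp only [s]
      rw [hSj, Finset.sum_range_succ, Nat.sub_self]
    have h := hes (κ j)
    simp only [this] at h
    convert h using 2
    ring

end Frobenius

/-- A perfectoid field contains elements of norm arbitrarily close to `1` with a compatible system
of `p`-power roots. -/
lemma IsPerfectoidField.exists_isRootSystem {p : ℕ} [hp : Fact p.Prime] {K : Type*}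
    [NontriviallyNormedField K] [IsUltrametricDist K] (hK : IsPerfectoidField p K) :
    ∃ π : ℕ → K, IsRootSystem p π ∧ 0 < ‖π 0‖₊ ∧ ‖π 0‖₊ < 1 ∧ ‖(p : K)‖₊ ≤ ‖π 0‖₊ ^ 4 := by
  have := hK.complete
  have hp1 : ‖(p : K)‖₊ < 1 := hK.norm_p_lt_one
  -- The exponent `1 / 4` yields `‖p‖ < ‖x‖ ^ 4`, so errors from `p` stay below the scale `ρ ^ 4`.
  obtain ⟨x, hx, hx1⟩ := hK.nondiscrete (‖(p : K)‖ ^ (1 / 4 : ℝ))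
    (Real.rpow_lt_one (norm_nonneg _) hK.norm_p_lt_one (by norm_num))
  have hx4 : ‖(p : K)‖ < ‖x‖ ^ 4 := by
    have h := pow_lt_pow_left₀ hx (by positivity) (n := 4) (by norm_num)
    rwa [← Real.rpow_natCast, ← Real.rpow_mul (norm_nonneg _), show (1 / 4 : ℝ) * (4 : ℕ) = 1 by
      norm_num, Real.rpow_one] at h
  have hpx : ‖(p : K)‖ < ‖x‖ := hx4.trans_le (pow_le_of_le_one (norm_nonneg _) hx1.le (by norm_num))
  let G := {y : K // ‖(p : K)‖ < ‖y‖ ∧ ‖y‖ ≤ 1}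
  have key : ∀ y : G, ∃ z : G, ‖z.1 ^ p - y.1‖ ≤ ‖(p : K)‖ := by
    rintro ⟨y, hy, hy1⟩
    obtain ⟨z, t, hz, ht, rfl⟩ := hK.frobenius_surjective y hy1
    have h1 : ‖(p : K) * t‖ ≤ ‖(p : K)‖ := by
      rw [norm_mul]; exact mul_le_of_le_one_right (norm_nonneg _) ht
    refine ⟨⟨z, ?_, hz⟩, ?_⟩
    · have h2 : ‖(p : K)‖ < ‖z ^ p‖ := by
        rcases le_max_iff.1 (IsUltrametricDist.norm_add_le_max (z ^ p) (p * t)) with h | h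
        · exact hy.trans_le h
        · exact absurd (hy.trans_le (h.trans h1)) (lt_irrefl _)
      rw [norm_pow] at h2
      exact h2.trans_le (pow_le_of_le_one (norm_nonneg _) hz hp.out.ne_zero)
    · simpa using h1
  choose f hf using key
  let y : ℕ → G := fun k => f^[k] ⟨x, hpx, hx1.le⟩
  obtain ⟨π, hπ, hπy⟩ := exists_isRootSystem_of_approx hp1 le_rfl (fun k => (y k).1)
    (fun k => (y k).2.2) (fun k => by
      have := hf (y k)
      simp only [y, Function.iterate_succ_apply'] at this ⊢
      exact this)
  -- Passing to exact roots moves `x` by at most `‖p‖ < ‖x‖`, which leaves its norm unchanged.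
  have h0 : ‖π 0‖ = ‖x‖ := by
    have h1 : ‖π 0 - x‖ ≤ ‖(p : K)‖ := hπy 0
    have h2 := IsUltrametricDist.norm_add_eq_max_of_norm_ne_norm
      (x := π 0 - x) (y := x) (h1.trans_lt hpx).ne
    rw [sub_add_cancel] at h2
    rw [h2, max_eq_right (h1.trans hpx.le)]
  have h0' : ‖π 0‖₊ = ‖x‖₊ := NNReal.eq h0
  refine ⟨π, hπ, ?_, ?_, ?_⟩
  · rw [h0', ← NNReal.coe_pos]
    exact (norm_nonneg _).trans_lt hpx
  · rw [h0']; exact hx1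
  · rw [h0']; exact hx4.le

/-- Modulo `X ^ N`, the polynomial `(1 + X) ^ b` has an inverse of degree less than `N`. -/
lemma Polynomial.exists_mul_one_add_X_pow_eq (R : Type*) [CommRing R] [Nontrivial R] (b : ℕ) {N : ℕ}
    (hN : 0 < N) :
    ∃ q r : Polynomial R, q.natDegree < N ∧ q * (1 + X) ^ b = 1 + X ^ N * r := by
  have hm : (X ^ N : Polynomial R).Monic := monic_X_pow N
  -- The truncated geometric series inverts `1 + X` modulo `X ^ N`; reducing its `b`-th power modulo
  -- `X ^ N` then gives the degree bound.
  obtain ⟨G, h1⟩ : ∃ G : Polynomial R, X ^ N ∣ G * (1 + X) - 1 := by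
    refine ⟨∑ i ∈ Finset.range N, (-X) ^ i, ?_⟩
    have := mul_neg_geom_sum (-X : Polynomial R) N
    rw [sub_neg_eq_add, mul_comm] at this
    rw [this, neg_pow, sub_sub_cancel_left, dvd_neg]
    exact Dvd.intro_left _ rfl
  have h2 : X ^ N ∣ G ^ b * (1 + X) ^ b - 1 := by
    rw [← mul_pow]
    have := sub_dvd_pow_sub_pow (G * (1 + X)) 1 b
    rw [one_pow] at this
    exact h1.trans this
  have h3 : X ^ N ∣ G ^ b %ₘ X ^ N - G ^ b := by
    rw [modByMonic_eq_sub_mul_div, sub_sub_cancel_left, dvd_neg]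
    exact dvd_mul_right _ _
  have h4 : X ^ N ∣ (G ^ b %ₘ X ^ N) * (1 + X) ^ b - 1 := by
    have : (G ^ b %ₘ X ^ N) * (1 + X) ^ b - 1 =
      (G ^ b %ₘ X ^ N - G ^ b) * (1 + X) ^ b + (G ^ b * (1 + X) ^ b - 1) := by ring
    rw [this]
    exact dvd_add (h3.mul_right _) h2
  obtain ⟨r, hr⟩ := h4
  refine ⟨G ^ b %ₘ X ^ N, r, ?_, by rw [← hr]; ring⟩
  have := natDegree_modByMonic_lt (G ^ b) hm (by
    intro h
    have := congrArg natDegree h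
    simp at this
    omega)
  simpa using this

section Valuation

variable {A : Type*} [CommRing A] (v : Valuation A ℝ≥0)

lemma Valuation.aeval_int_le (hv : ∀ z : ℤ, v z ≤ 1) {u : A} {C : ℝ≥0} (hu : v u ≤ C) (hC : 1 ≤ C)
    {q : Polynomial ℤ} {N : ℕ} (hq : q.natDegree < N) : v (Polynomial.aeval u q) ≤ C ^ N := by
  rw [Polynomial.aeval_eq_sum_range' hq]
  refine v.map_sum_le fun i hi => ?_
  rw [zsmul_eq_mul, map_mul, map_pow]
  calc _ ≤ 1 * C ^ i := by gcongr; exact hv _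
    _ ≤ C ^ N := by rw [one_mul]; exact pow_le_pow_right₀ hC (Finset.mem_range.1 hi).le

end Valuation

/-! ### Approximation of Laurent monomials with uniform bounds -/

section Approximation

variable {K : Type*} [NormedField K] [IsUltrametricDist K]
  {L : Type*} [NormedField L] [IsUltrametricDist L] [Algebra K L]
  {A : Type*} [CommRing A] [Algebra K A] {v : Valuation A ℝ≥0} {φ : A →ₐ[K] L}

lemma valuation_intCast_le_one (hv : ∀ a : K, v (algebraMap K A a) = ‖a‖₊) (z : ℤ) : v z ≤ 1 := by
  rw [← map_intCast (algebraMap K A), hv]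
  exact IsUltrametricDist.nnnorm_intCast_le_one K z

lemma nnnorm_aeval_int_le_one {u : L} (hu : ‖u‖₊ ≤ 1) (q : Polynomial ℤ) :
    ‖Polynomial.aeval u q‖₊ ≤ 1 := by
  rw [Polynomial.aeval_eq_sum_range]
  refine IsUltrametricDist.nnnorm_sum_le_of_forall_le fun i _ => ?_
  rw [zsmul_eq_mul, nnnorm_mul, nnnorm_pow]
  exact mul_le_one' (IsUltrametricDist.nnnorm_intCast_le_one L _) (pow_le_one' hu _)

-- This element is the preimage of `E - 1` built from preimages `D` of `P` and `W` of `c * E / P`;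
-- its only cost is the factor `c⁻¹`.
omit [IsUltrametricDist K] in
lemma valuation_unit_sub_one_le (hv : ∀ a : K, v (algebraMap K A a) = ‖a‖₊) {c : K} (hc : c ≠ 0)
    (hc1 : ‖c‖₊ ≤ 1) {D W : A} (hD : v D ≤ 1) (hW : v W ≤ 1) :
    v (algebraMap K A c⁻¹ * (D * W) - 1) ≤ ‖c‖₊⁻¹ := by
  refine (v.map_sub _ _).trans (max_le ?_ ?_)
  · rw [map_mul, map_mul, hv, nnnorm_inv]
    exact mul_le_of_le_one_right zero_le (mul_le_one' hD hW)
  · rw [map_one]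
    exact one_le_inv_iff₀.2 ⟨by simpa using hc, hc1⟩

omit [IsUltrametricDist K] [IsUltrametricDist L] in
lemma map_unit_sub_one {c : K} (hc : c ≠ 0) {D W : A} {P E : L} (hP : P ≠ 0) (hφD : φ D = P)
    (hφW : φ W = algebraMap K L c * E / P) : φ (algebraMap K A c⁻¹ * (D * W) - 1) = E - 1 := by
  have hc' : algebraMap K L c ≠ 0 := by simpa using hc
  rw [map_sub, map_mul, map_mul, map_one, AlgHom.commutes, hφD, hφW, map_inv₀]
  field_simp

/-- Approximation of a Laurent monomial `ϖ ^ e * x / P ^ b`, given elements with images `x`, `P`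
and `ϖ ^ M * E / P` where `E` is a principal unit. -/
lemma exists_approx_monomial (hv : ∀ a : K, v (algebraMap K A a) = ‖a‖₊)
    {ϖ : K} {ρ : ℝ≥0} (hρ0 : 0 < ρ) (hρ1 : ρ ≤ 1) {n : ℕ} (hn : 0 < n) (hϖ : ‖ϖ‖₊ ^ n = ρ) {M : ℕ}
    {S D W : A} (hS : v S ≤ 1) (hD : v D ≤ 1) (hW : v W ≤ 1) {x P E : L} (hP : P ≠ 0)
    (hφS : φ S = x) (hφD : φ D = P) (hφW : φ W = algebraMap K L (ϖ ^ M) * E / P)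
    (hE : ‖E - 1‖₊ ^ n ≤ ρ ^ 2) {e : ℤ} {b : ℕ} (he : e.natAbs ≤ n) (hb : b * M ≤ n)
    (hz : ‖algebraMap K L (ϖ ^ e) * x / P ^ b‖₊ ≤ 1) :
    ∃ g : A, v g ≤ ρ⁻¹ ^ (2 + 2 * M) ∧ ‖φ g - algebraMap K L (ϖ ^ e) * x / P ^ b‖₊ ≤ ρ ^ 4 := by
  have hϖ1 : ‖ϖ‖₊ ≤ 1 := (pow_le_one_iff hn.ne').1 (hϖ ▸ hρ1)
  have hϖ0 : ϖ ≠ 0 := by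
    rintro rfl
    rw [nnnorm_zero, zero_pow hn.ne'] at hϖ
    exact hρ0.ne hϖ
  have hϖ0' : 0 < ‖ϖ‖₊ := by simpa using hϖ0
  have hc0 : ϖ ^ M ≠ 0 := pow_ne_zero _ hϖ0
  have hc0' : algebraMap K L (ϖ ^ M) ≠ 0 := by
    rwa [ne_eq, FaithfulSMul.algebraMap_eq_zero_iff]
  have hc1 : ‖ϖ ^ M‖₊ ≤ 1 := by rw [nnnorm_pow]; exact pow_le_one' hϖ1 _
  have hu1 : ‖E - 1‖₊ ≤ 1 :=
    (pow_le_one_iff hn.ne').1 (hE.trans (pow_le_one' hρ1 _))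
  have hi1 : 1 ≤ ‖ϖ‖₊⁻¹ := one_le_inv_iff₀.2 ⟨hϖ0', hϖ1⟩
  have hin : ‖ϖ‖₊⁻¹ ^ n = ρ⁻¹ := by rw [inv_pow, hϖ]
  -- Truncation at `2 * n` makes the remainder `(E - 1) ^ (2 * n)` at most `ρ ^ 4`, while `q`
  -- evaluated at the preimage of `E - 1` costs at most `‖ϖ ^ M‖⁻¹ ^ (2 * n) = ρ⁻¹ ^ (2 * M)`.
  obtain ⟨q, r, hq, hqr⟩ := Polynomial.exists_mul_one_add_X_pow_eq ℤ b
    (N := 2 * n) (by omega)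
  set U : A := algebraMap K A (ϖ ^ M)⁻¹ * (D * W) - 1 with hU
  have hvU : v U ≤ ‖ϖ ^ M‖₊⁻¹ := valuation_unit_sub_one_le hv hc0 hc1 hD hW
  have hφU : φ U = E - 1 := map_unit_sub_one hc0 hP hφD hφW
  -- The image is `ϖ ^ e * x * (E / P) ^ b * q (E - 1)`, and `E ^ b * q (E - 1)` is `1` up to the
  -- remainder. The scalars cost only `ρ⁻¹` each because `|e|` and `b * M` are at most `n`.
  refine ⟨algebraMap K A (ϖ ^ e * (ϖ ^ M)⁻¹ ^ b) * S * W ^ b * Polynomial.aeval U q, ?_, ?_⟩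
  · have h1 : ‖ϖ ^ e‖₊ ≤ ρ⁻¹ := by
      rw [nnnorm_zpow, ← hin, ← inv_inv (‖ϖ‖₊ ^ e), ← inv_zpow, ← zpow_neg, ← zpow_natCast]
      exact zpow_le_zpow_right₀ hi1 (by omega)
    have h2 : ‖(ϖ ^ M)⁻¹ ^ b‖₊ ≤ ρ⁻¹ := by
      rw [nnnorm_pow, nnnorm_inv, nnnorm_pow, ← hin, ← inv_pow, ← pow_mul, mul_comm]
      exact pow_le_pow_right₀ hi1 hb
    have h3 : v (Polynomial.aeval U q) ≤ ρ⁻¹ ^ (2 * M) := by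
      refine (v.aeval_int_le (valuation_intCast_le_one hv) hvU
        (one_le_inv_iff₀.2 ⟨nnnorm_pos.2 hc0, hc1⟩) hq).trans_eq ?_
      rw [nnnorm_pow, ← inv_pow, ← pow_mul, ← hin, ← pow_mul]
      congr 1
      ring
    rw [map_mul, map_mul, map_mul, map_pow, hv, nnnorm_mul]
    calc _ ≤ (ρ⁻¹ * ρ⁻¹) * 1 * 1 * ρ⁻¹ ^ (2 * M) := by
          gcongr
          exact pow_le_one' hW b
      _ = _ := by ring
  · have h1 : φ (algebraMap K A (ϖ ^ e * (ϖ ^ M)⁻¹ ^ b) * S * W ^ b * Polynomial.aeval U q) -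
        algebraMap K L (ϖ ^ e) * x / P ^ b =
        (algebraMap K L (ϖ ^ e) * x / P ^ b) * ((E - 1) ^ (2 * n) * Polynomial.aeval (E - 1) r) := by
      have h2 := congrArg (Polynomial.aeval (E - 1)) hqr
      simp only [map_mul, map_add, map_one, map_pow, Polynomial.aeval_X, add_sub_cancel] at h2
      have h3 : φ (Polynomial.aeval U q) = Polynomial.aeval (E - 1) q := by
        rw [← hφU, ← AlgHom.restrictScalars_apply ℤ φ, ← Polynomial.aeval_algHom_apply]; rfl
      rw [map_mul, map_mul, map_mul, map_pow, AlgHom.commutes, h3, hφS, hφW, map_mul,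
        map_pow _ (ϖ ^ M)⁻¹, map_inv₀, eq_sub_of_add_eq' h2.symm, div_pow, mul_pow,
        inv_pow]
      field_simp
    have h4 : ‖E - 1‖₊ ^ (2 * n) ≤ (ρ ^ 2) ^ 2 := by
      rw [mul_comm, pow_mul]
      gcongr
    rw [h1, nnnorm_mul, nnnorm_mul, nnnorm_pow]
    calc _ ≤ 1 * ((ρ ^ 2) ^ 2 * 1) := by
          exact mul_le_mul' hz (mul_le_mul' h4 (nnnorm_aeval_int_le_one hu1 r))
      _ = ρ ^ 4 := by ring

/-- The elements `π ^ e j * x j / P ^ b j` are approximated by values of `φ` with uniform bounds,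
if `E` is the root system `1 + ∑ j, (π ^ e j * x j / P ^ b j) ^ p ^ κ j`, up to a small error. -/
lemma exists_approx_of_root_systems {p : ℕ} [hp : Fact p.Prime]
    (hv : ∀ a : K, v (algebraMap K A a) = ‖a‖₊)
    {π : ℕ → K} (hπ : IsRootSystem p π) {ρ : ℝ≥0} (hπρ : ‖π 0‖₊ = ρ) (hρ0 : 0 < ρ) (hρ1 : ρ < 1)
    {M : ℕ} {x : ℕ → ℕ → L} {P E : ℕ → L} (hP : ∀ m, P m ≠ 0) {e : ℕ → ℤ} {b : ℕ → ℕ}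
    {τ : ℕ → ℕ → L} (hτ : ∀ j m, τ j m = algebraMap K L (π m ^ e j) * x j m / P m ^ b j)
    (hτ1 : ∀ j m, ‖τ j m‖₊ ≤ 1) {κ : ℕ → ℕ}
    (hκ : ∀ i j, i < j → (e i).natAbs + b i * M ≤ κ j - κ i)
    (hE : ∀ k, ‖E k - 1‖₊ ^ p ^ k ≤ ρ ^ 2)
    (hE' : ∀ j, ‖E (κ j) - 1 - ∑ i ∈ Finset.range j, τ i (κ j - κ i) - τ j 0‖₊ ≤ ρ ^ 4)
    {S : ℕ → ℕ → A} {D W : ℕ → A} (hS : ∀ j m, v (S j m) ≤ 1) (hD : ∀ m, v (D m) ≤ 1)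
    (hW : ∀ m, v (W m) ≤ 1) (hφS : ∀ j m, φ (S j m) = x j m) (hφD : ∀ m, φ (D m) = P m)
    (hφW : ∀ m, φ (W m) = algebraMap K L (π m ^ M) * E m / P m) (j : ℕ) :
    ∃ g : A, v g ≤ ρ⁻¹ ^ (2 + 2 * M) ∧ ‖φ g - τ j 0‖₊ ≤ ρ ^ 4 := by
  have hπm : ∀ m, ‖π m‖₊ ^ p ^ m = ρ := fun m => (hπ.nnnorm_pow m).trans hπρ
  have hπ0 : ∀ m, π m ≠ 0 := by
    intro m h
    have := hπm m
    rw [h, nnnorm_zero, zero_pow (pow_ne_zero _ hp.out.ne_zero)] at this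
    exact hρ0.ne this
  have hπ1 : ∀ m, ‖π m‖₊ ≤ 1 := fun m => hπ.nnnorm_le_one (hπρ.trans_le hρ1.le) m
  -- The gap `κ j - κ i` bounds `|e i|` and `b i * M`, hence so does `p ^ (κ j - κ i)`, the exponent
  -- `n` of the monomial approximation.
  have hmono : ∀ i < j, ∃ g : A, v g ≤ ρ⁻¹ ^ (2 + 2 * M) ∧
      ‖φ g - τ i (κ j - κ i)‖₊ ≤ ρ ^ 4 := by
    intro i hi
    have h1 := hκ i j hi
    have h2 : κ j - κ i < p ^ (κ j - κ i) := Nat.lt_pow_self hp.out.one_lt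
    rw [hτ]
    refine exists_approx_monomial hv hρ0 hρ1.le (pow_pos hp.out.pos _) (hπm _) (hS i _) (hD _)
      (hW _) (hP _) (hφS i _) (hφD _) (hφW _) (hE _) (by omega) (by omega) ?_
    rw [← hτ]
    exact hτ1 _ _
  choose! g hg hg' using hmono
  set k := κ j
  have hc0 : π k ^ M ≠ 0 := pow_ne_zero _ (hπ0 k)
  have hc1 : ‖π k ^ M‖₊ ≤ 1 := by rw [nnnorm_pow]; exact pow_le_one' (hπ1 k) _
  -- The first term maps exactly to `E k - 1`; removing the approximated earlier summands leaves `τ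
  -- j 0`.
  refine ⟨(algebraMap K A (π k ^ M)⁻¹ * (D k * W k) - 1) - ∑ i ∈ Finset.range j, g i, ?_, ?_⟩
  · have hρi : 1 ≤ ρ⁻¹ := one_le_inv_iff₀.2 ⟨hρ0, hρ1.le⟩
    refine (v.map_sub _ _).trans (max_le ?_ (v.map_sum_le fun i hi => hg i (Finset.mem_range.1 hi)))
    refine (valuation_unit_sub_one_le hv hc0 hc1 (hD k) (hW k)).trans ?_
    have h1 : ‖π k‖₊⁻¹ ≤ ρ⁻¹ := by
      rw [← hπm k]
      refine inv_anti₀ (pow_pos (by simpa using hπ0 k) _) ?_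
      exact pow_le_of_le_one zero_le (hπ1 k) (pow_ne_zero _ hp.out.ne_zero)
    calc ‖π k ^ M‖₊⁻¹ = ‖π k‖₊⁻¹ ^ M := by rw [nnnorm_pow, inv_pow]
      _ ≤ ρ⁻¹ ^ M := by gcongr
      _ ≤ _ := pow_le_pow_right₀ hρi (by omega)
  · rw [map_sub, map_unit_sub_one hc0 (hP k) (hφD k) (hφW k), map_sum]
    have : E k - 1 - ∑ i ∈ Finset.range j, φ (g i) - τ j 0 =
        (E k - 1 - ∑ i ∈ Finset.range j, τ i (k - κ i) - τ j 0) -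
        ∑ i ∈ Finset.range j, (φ (g i) - τ i (k - κ i)) := by
      rw [Finset.sum_sub_distrib]; ring
    rw [this, sub_eq_add_neg]
    refine (IsUltrametricDist.nnnorm_add_le_max _ _).trans (max_le (hE' j) ?_)
    rw [nnnorm_neg]
    exact IsUltrametricDist.nnnorm_sum_le_of_forall_le fun i hi => hg' i (Finset.mem_range.1 hi)

end Approximation

/-! ### Successive approximation and openness -/

section Open

variable {G H : Type*} [SeminormedAddCommGroup G] [CompleteSpace G] [NormedAddCommGroup H]

/-- A continuous homomorphism from a complete group which hits every element up to a fixed relative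
error, by elements of controlled norm, is open and surjective. -/
lemma isOpenQuotientMap_of_approx (f : G →+ H) (hf : Continuous f) {C e : ℝ} (hC : 0 ≤ C)
    (he : 0 ≤ e) (he1 : e < 1) (h : ∀ z : H, ∃ g : G, ‖g‖ ≤ C * ‖z‖ ∧ ‖f g - z‖ ≤ e * ‖z‖) :
    IsOpenQuotientMap f := by
  choose s hs hs' using h
  have key : ∀ z : H, ∃ g : G, f g = z ∧ ‖g‖ ≤ C * ‖z‖ * (1 - e)⁻¹ := by
    intro z
    -- The successive residuals; they decay like `e ^ n`, so the chosen approximate preimages form a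
    -- convergent series.
    let y : ℕ → H := fun n => (fun w => w - f (s w))^[n] z
    have hy : ∀ n, y (n + 1) = y n - f (s (y n)) := fun n => Function.iterate_succ_apply' _ _ _
    have hyn : ∀ n, ‖y n‖ ≤ e ^ n * ‖z‖ := by
      intro n
      induction n with
      | zero => simp [y]
      | succ n ih =>
        rw [hy, norm_sub_rev, pow_succ', mul_assoc]
        exact (hs' _).trans (by gcongr)
    have hb : ∀ n, ‖s (y n)‖ ≤ C * ‖z‖ * e ^ n := fun n => by
      calc _ ≤ C * ‖y n‖ := hs _
        _ ≤ C * (e ^ n * ‖z‖) := by gcongr; exact hyn n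
        _ = _ := by ring
    have hgeo : HasSum (fun n => C * ‖z‖ * e ^ n) (C * ‖z‖ * (1 - e)⁻¹) :=
      (hasSum_geometric_of_lt_one he he1).mul_left _
    have hsum : Summable fun n => s (y n) := .of_norm_bounded hgeo.summable hb
    refine ⟨∑' n, s (y n), ?_, tsum_of_norm_bounded hgeo hb⟩
    have h1 : Filter.Tendsto (fun n => f (∑ i ∈ Finset.range n, s (y i))) Filter.atTop
        (nhds (f (∑' n, s (y n)))) := (hf.tendsto _).comp hsum.hasSum.tendsto_sum_nat
    have h2 : ∀ n, f (∑ i ∈ Finset.range n, s (y i)) = z - y n := by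
      intro n
      induction n with
      | zero => simp [y]
      | succ n ih => rw [Finset.sum_range_succ, map_add, ih, hy]; abel
    have h3 : Filter.Tendsto y Filter.atTop (nhds 0) := by
      refine squeeze_zero_norm hyn ?_
      simpa using (tendsto_pow_atTop_nhds_zero_of_lt_one he he1).mul_const ‖z‖
    simp_rw [h2] at h1
    refine tendsto_nhds_unique h1 ?_
    simpa using h3.const_sub z
  refine ⟨fun z => (key z).imp fun g hg => hg.1, hf, ?_⟩
  refine IsOpenMap.of_nhds_le fun g => ?_
  intro U hU
  rw [Filter.mem_map, Metric.mem_nhds_iff] at hU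
  obtain ⟨ε, hε, hU⟩ := hU
  have he' : 0 < (1 - e)⁻¹ := inv_pos.2 (sub_pos.2 he1)
  rw [Metric.mem_nhds_iff]
  -- `C + 1` instead of `C` keeps the denominator positive when `C = 0`.
  refine ⟨ε / ((C + 1) * (1 - e)⁻¹), by positivity, fun z hz => ?_⟩
  obtain ⟨t, ht, ht'⟩ := key (z - f g)
  have hmem : g + t ∈ Metric.ball g ε := by
    rw [mem_ball_iff_norm, add_sub_cancel_left]
    rw [mem_ball_iff_norm, lt_div_iff₀ (by positivity)] at hz
    refine ht'.trans_lt (lt_of_le_of_lt ?_ hz)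
    have := norm_nonneg (z - f g)
    nlinarith [mul_nonneg this he'.le]
  have := hU hmem
  simpa [ht] using this

end Open

/-! ### Exponents in `ℤ[1/p]_{≥ 0}` and evaluation at root systems -/

namespace PExp

variable {p : ℕ} [hp : Fact p.Prime]

/-- Division by `p ^ m` on the exponents `ℤ[1/p]_{≥ 0}`. -/
def divPow (m : ℕ) (q : PExp p) : PExp p :=
  ⟨q / (p : ℚ≥0) ^ m, by
    obtain ⟨k, n, h⟩ := q.2
    refine ⟨k + m, n, ?_⟩
    have : (p : ℚ≥0) ≠ 0 := Nat.cast_ne_zero.2 hp.out.ne_zero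
    rw [← h, pow_add]
    field_simp⟩

lemma coe_divPow (m : ℕ) (q : PExp p) : (divPow m q : ℚ≥0) = q / (p : ℚ≥0) ^ m := rfl

lemma nsmul_divPow_succ (m : ℕ) (q : PExp p) : p • divPow (m + 1) q = divPow m q := by
  have : (p : ℚ≥0) ≠ 0 := Nat.cast_ne_zero.2 hp.out.ne_zero
  refine Subtype.ext ?_
  rw [AddSubmonoidClass.coe_nsmul, coe_divPow, coe_divPow, nsmul_eq_mul, pow_succ]
  field_simp

lemma divPow_zero (q : PExp p) : divPow 0 q = q := Subtype.ext <| by simp [coe_divPow]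

/-- Natural numbers as exponents. -/
def ofNat (p n : ℕ) : PExp p := ⟨n, 0, n, by simp⟩

omit hp in
lemma coe_ofNat (n : ℕ) : (ofNat p n : ℚ≥0) = n := rfl

omit hp in
lemma exists_common_denominator {ι : Type*} [Fintype ι] (q : ι → PExp p) :
    ∃ (k : ℕ) (n : ι → ℕ), ∀ i, (q i : ℚ≥0) * (p : ℚ≥0) ^ k = n i := by
  choose k n h using fun i => (q i).2
  refine ⟨∑ i, k i, fun i => n i * p ^ (∑ j, k j - k i), fun i => ?_⟩
  have hle : k i ≤ ∑ j, k j := Finset.single_le_sum (fun _ _ => zero_le) (Finset.mem_univ i)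
  push_cast
  rw [← h i, mul_assoc, ← pow_add, Nat.add_sub_cancel' hle]

/-- A complementary exponent: it turns the inverse of a monomial into a monomial divided by a power
of `x₁ ⋯ xₙ`. -/
lemma exists_add_eq_ofNat {ι : Type*} [Fintype ι] (q : ι → PExp p) :
    ∃ (B : ℕ) (s : ι → PExp p), s + q = fun _ => ofNat p B := by
  obtain ⟨k, n, h⟩ := exists_common_denominator q
  have hq : ∀ i, (q i : ℚ≥0) ≤ (∑ i, n i : ℕ) := by
    intro i
    have h1 : (n i : ℚ≥0) ≤ (∑ i, n i : ℕ) := by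
      exact_mod_cast Finset.single_le_sum (fun _ _ => zero_le) (Finset.mem_univ i)
    refine le_trans ?_ h1
    rw [← h]
    exact le_mul_of_one_le_right zero_le (one_le_pow₀ (by exact_mod_cast hp.out.one_le))
  refine ⟨∑ i, n i, fun i => ⟨(∑ i, n i : ℕ) - q i, k, (∑ i, n i) * p ^ k - n i, ?_⟩, ?_⟩
  · rw [tsub_mul, h i]
    push_cast
    rfl
  · funext i
    exact Subtype.ext (tsub_add_cancel_of_le (hq i))

end PExp

section Eval

variable {p : ℕ} {M : Type*} [CommMonoid M]

/-- The power `a ^ q` for a system `a` of `p`-power roots and `q ∈ ℤ[1/p]_{≥ 0}`. -/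
def rootPow (a : ℕ → M) (q : PExp p) : M :=
  a q.2.choose ^ q.2.choose_spec.choose

/-- The power does not depend on the chosen fraction `n / p ^ k`: two representations are compared
at the common level `k + k'`. -/
lemma rootPow_eq {a : ℕ → M} (ha : IsRootSystem p a) {q : PExp p} {k n : ℕ}
    (h : (q : ℚ≥0) * (p : ℚ≥0) ^ k = n) : rootPow a q = a k ^ n := by
  have h' := q.2.choose_spec.choose_spec
  rw [rootPow]
  set k' := q.2.choose
  set n' := q.2.choose_spec.choose
  have hn : p ^ k * n' = p ^ k' * n := by
    have : ((p ^ k * n' : ℕ) : ℚ≥0) = (p ^ k' * n : ℕ) := by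
      push_cast
      rw [← h, ← h']
      ring
    exact_mod_cast this
  rw [← ha.pow_pow k' k, ← ha.pow_pow k k', ← pow_mul, ← pow_mul, hn, add_comm k k']

lemma rootPow_zero {a : ℕ → M} (ha : IsRootSystem p a) : rootPow a (0 : PExp p) = 1 := by
  rw [rootPow_eq ha (k := 0) (n := 0) (by simp), pow_zero]

lemma rootPow_add {a : ℕ → M} (ha : IsRootSystem p a) (q q' : PExp p) :
    rootPow a (q + q') = rootPow a q * rootPow a q' := by
  obtain ⟨k, n, h⟩ := q.2
  obtain ⟨k', n', h'⟩ := q'.2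
  have h1 : (q : ℚ≥0) * (p : ℚ≥0) ^ (k + k') = (n * p ^ k' : ℕ) := by
    push_cast; rw [← h]; ring
  have h2 : (q' : ℚ≥0) * (p : ℚ≥0) ^ (k + k') = (n' * p ^ k : ℕ) := by
    push_cast; rw [← h']; ring
  have h3 : ((q + q' : PExp p) : ℚ≥0) * (p : ℚ≥0) ^ (k + k') = (n * p ^ k' + n' * p ^ k : ℕ) := by
    rw [Nat.cast_add, ← h1, ← h2, AddSubmonoid.coe_add, add_mul]
  rw [rootPow_eq ha h1, rootPow_eq ha h2, rootPow_eq ha h3, pow_add]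

lemma rootPow_divPow_one [hp : Fact p.Prime] {a : ℕ → M} (ha : IsRootSystem p a) (m : ℕ) :
    rootPow a (PExp.divPow m (PExp.ofNat p 1)) = a m := by
  have : (p : ℚ≥0) ≠ 0 := Nat.cast_ne_zero.2 hp.out.ne_zero
  rw [rootPow_eq ha (k := m) (n := 1) (by
    rw [PExp.coe_divPow, PExp.coe_ofNat]
    simp [this]), pow_one]

end Eval

section EvalHom

variable {p : ℕ} {K : Type*} [NormedField K]
  {L : Type*} [NormedField L] [Algebra K L] {N : ℕ}

/-- Evaluation of elements of `K[T₁^{1/p^∞}, …]` at systems of `p`-power roots. -/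
def evalRoots (K : Type*) [NormedField K] [Algebra K L] (R : Fin N → ℕ → L)
    (hR : ∀ i, IsRootSystem p (R i)) : PerfPoly p K N →ₐ[K] L :=
  AddMonoidAlgebra.lift K L (Fin N → PExp p)
    { toFun := fun q => ∏ i, rootPow (R i) (q.toAdd i)
      map_one' := by simp [rootPow_zero (hR _)]
      map_mul' := fun q q' => by
        simp [rootPow_add (hR _), Finset.prod_mul_distrib] }

lemma evalRoots_single (R : Fin N → ℕ → L) (hR : ∀ i, IsRootSystem p (R i)) (q : Fin N → PExp p)
    (a : K) : evalRoots K R hR (AddMonoidAlgebra.single q a) =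
      algebraMap K L a * ∏ i, rootPow (R i) (q i) := by
  rw [evalRoots, AddMonoidAlgebra.lift_single, Algebra.smul_def]
  rfl

lemma evalRoots_single_single (R : Fin N → ℕ → L) (hR : ∀ i, IsRootSystem p (R i)) (i : Fin N)
    (q : PExp p) :
    evalRoots K R hR (AddMonoidAlgebra.single (Pi.single i q) 1) = rootPow (R i) q := by
  rw [evalRoots_single, map_one, one_mul, Finset.prod_eq_single i, Pi.single_eq_same]
  · intro j _ hj
    rw [Pi.single_eq_of_ne hj, rootPow_zero (hR j)]
  · simp

lemma nnnorm_evalRoots_le [hp : Fact p.Prime] [IsUltrametricDist L] (hL : ∀ a : K, ‖algebraMap K L a‖₊ = ‖a‖₊)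
    (R : Fin N → ℕ → L) (hR : ∀ i, IsRootSystem p (R i)) (hR1 : ∀ i, ‖R i 0‖₊ ≤ 1)
    (f : PerfPoly p K N) :
    ‖evalRoots K R hR f‖₊ ≤ gaussNormFun (fun _ => ⟨1, one_pos⟩) f := by
  rw [evalRoots, AddMonoidAlgebra.lift_apply', Finsupp.sum]
  refine IsUltrametricDist.nnnorm_sum_le_of_forall_le fun q _ => ?_
  refine le_trans ?_ (le_gaussNormFun _ f q)
  rw [nnnorm_mul, hL]
  gcongr
  have : monomialNorm (fun _ => ⟨1, one_pos⟩ : Polyradius N) q = 1 := by simp [monomialNorm]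
  rw [this]
  simp only [MonoidHom.coe_mk, OneHom.coe_mk, toAdd_ofAdd, nnnorm_prod]
  refine Finset.prod_le_one' fun i _ => ?_
  rw [rootPow, nnnorm_pow]
  exact pow_le_one' ((hR i).nnnorm_le_one (hR1 i) _) _

end EvalHom

/-! ### The completed field and the embedding of polynomials -/

section GaussField

variable {p : ℕ} {K : Type*} [NormedField K] [IsUltrametricDist K] {n : ℕ} (r : Polyradius n)

/-- The inclusion `K[x₁^{1/p^∞}, …] → K_r^perfd`. -/
def gaussIncl : PerfPoly p K n →ₐ[K] PerfdGaussField p K r where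
  toFun f := ((WithAbs.toAbs (gaussAbsFrac p K r) (algebraMap _ (PerfRatFunc p K n) f) :
    WithAbs (gaussAbsFrac p K r)) : PerfdGaussField p K r)
  map_one' := by rw [map_one]; rfl
  map_mul' f g := by rw [map_mul, WithAbs.toAbs_mul, UniformSpace.Completion.coe_mul]
  map_zero' := by rw [map_zero]; rfl
  map_add' f g := by rw [map_add, WithAbs.toAbs_add, UniformSpace.Completion.coe_add]
  commutes' a := by
    rw [UniformSpace.Completion.algebraMap_def, WithAbs.algebraMap_right_apply,
      IsScalarTower.algebraMap_apply K (PerfPoly p K n) (PerfRatFunc p K n)]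

lemma nnnorm_gaussIncl (f : PerfPoly p K n) : ‖gaussIncl r f‖₊ = gaussNormFun r f := by
  refine NNReal.eq ?_
  change ‖((WithAbs.toAbs (gaussAbsFrac p K r) (algebraMap _ (PerfRatFunc p K n) f) :
    WithAbs (gaussAbsFrac p K r)) : PerfdGaussField p K r)‖ = _
  rw [UniformSpace.Completion.norm_coe, WithAbs.norm_toAbs_eq]
  change ((gaussValuationFrac p K r _ : ℝ≥0) : ℝ) = _
  rw [gaussValuationFrac, Valuation.extendToLocalization_apply_map_apply]
  rfl

instance : IsUltrametricDist (PerfdGaussField p K r) := by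
  refine IsUltrametricDist.isUltrametricDist_of_forall_norm_add_le_max_norm fun x y => ?_
  refine UniformSpace.Completion.induction_on₂ x y
    (isClosed_le (by fun_prop) (by fun_prop)) fun a b => ?_
  rw [← UniformSpace.Completion.coe_add, UniformSpace.Completion.norm_coe,
    UniformSpace.Completion.norm_coe, UniformSpace.Completion.norm_coe]
  exact_mod_cast (gaussValuationFrac p K r).map_add a.ofAbs b.ofAbs

lemma nnnorm_algebraMap_gaussField (a : K) :
    ‖algebraMap K (PerfdGaussField p K r) a‖₊ = ‖a‖₊ := by
  rw [← (gaussIncl r).commutes, nnnorm_gaussIncl]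
  exact (gaussNormFun_single r 0 a).trans (by rw [monomialNorm_zero, mul_one])

lemma dense_gaussIncl_div (z : PerfdGaussField p K r) {S : Set (PerfdGaussField p K r)}
    (hS : IsClosed S) (h : ∀ f g : PerfPoly p K n, g ≠ 0 → gaussIncl r f / gaussIncl r g ∈ S) :
    z ∈ S := by
  refine UniformSpace.Completion.induction_on z hS fun a => ?_
  obtain ⟨f, g, hg, hfg⟩ := IsFractionRing.div_surjective (A := PerfPoly p K n) a.ofAbs
  have := h f g (nonZeroDivisors.ne_zero hg)
  have h2 : a = WithAbs.toAbs (gaussAbsFrac p K r) (algebraMap _ _ f) /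
    WithAbs.toAbs (gaussAbsFrac p K r) (algebraMap _ _ g) := by
    rw [← WithAbs.toAbs_div, hfg, WithAbs.toAbs_ofAbs]
  rw [h2]
  convert this using 1
  exact map_div₀ (UniformSpace.Completion.coeRingHom :
    WithAbs (gaussAbsFrac p K r) →+* PerfdGaussField p K r) _ _

end GaussField

/-! ### Free polyradii: dominant monomials and density of Laurent polynomials -/

section Monomial

variable {p : ℕ} {K : Type*} [NormedField K] {n : ℕ}

lemma monomialNorm_pow (r : Polyradius n) {q : Fin n → PExp p} {k : ℕ} {m : Fin n → ℕ}
    (h : ∀ i, (q i : ℚ≥0) * (p : ℚ≥0) ^ k = m i) :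
    monomialNorm r q ^ p ^ k = ∏ i, (r i : ℝ≥0) ^ m i := by
  rw [monomialNorm, ← Finset.prod_pow]
  refine Finset.prod_congr rfl fun i _ => ?_
  rw [← NNReal.rpow_natCast, ← NNReal.rpow_mul, ← NNReal.rpow_natCast]
  congr 1
  have := congrArg (fun x : ℚ≥0 => (x : ℝ)) (h i)
  push_cast at this ⊢
  exact this

/-- For a free polyradius, distinct monomials have distinct norms. -/
lemma IsFreePolyradius.monomial_injective [hp : Fact p.Prime] {r : Polyradius n}
    (hr : IsFreePolyradius K r) {q q' : Fin n → PExp p} {a a' : K} (ha : a ≠ 0) (ha' : a' ≠ 0)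
    (h : ‖a‖₊ * monomialNorm r q = ‖a'‖₊ * monomialNorm r q') : q = q' := by
  obtain ⟨k, m, hm⟩ := PExp.exists_common_denominator (Sum.elim q q')
  have h1 := monomialNorm_pow r (q := q) (fun i => hm (Sum.inl i))
  have h2 := monomialNorm_pow r (q := q') (fun i => hm (Sum.inr i))
  have hpos := monomialNorm_pos r q'
  have hna : ‖a‖₊ ≠ 0 := by simpa using ha
  -- Raising to the power `p ^ k` makes all exponents integral, so an equality of norms becomes a
  -- multiplicative relation between the `r i` and `|Kˣ|`.
  have h0 := hr (fun i => (m (Sum.inl i) : ℤ) - m (Sum.inr i)) ⟨1, one_pos, (a' / a) ^ p ^ k,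
    pow_ne_zero _ (div_ne_zero ha' ha), by
      have hr0 : ∀ i, (r i : ℝ≥0) ≠ 0 := fun i => (r i).2.ne'
      simp only [pow_one, zpow_sub₀ (hr0 _), zpow_natCast, Finset.prod_div_distrib]
      rw [← h1, ← h2, nnnorm_pow, nnnorm_div, ← div_pow]
      congr 1
      rw [div_eq_div_iff hpos.ne' hna, mul_comm, h]⟩
  have hpk : (p : ℚ≥0) ^ k ≠ 0 := pow_ne_zero _ (Nat.cast_ne_zero.2 hp.out.ne_zero)
  funext i
  have h3 := congrFun h0 i
  simp only [Pi.zero_apply, sub_eq_zero, Nat.cast_inj] at h3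
  refine Subtype.ext (mul_right_cancel₀ hpk ?_)
  have h4 := hm (Sum.inl i)
  have h5 := hm (Sum.inr i)
  simp only [Sum.elim_inl, Sum.elim_inr] at h4 h5
  rw [h4, h5, h3]

/-- For a free polyradius, every nonzero element is dominated by a single monomial. -/
lemma IsFreePolyradius.exists_dominant [IsUltrametricDist K] [hp : Fact p.Prime] {r : Polyradius n}
    (hr : IsFreePolyradius K r) {g : PerfPoly p K n} (hg : g ≠ 0) :
    ∃ (q : Fin n → PExp p) (a : K) (h : PerfPoly p K n), a ≠ 0 ∧
      g = AddMonoidAlgebra.single q a + h ∧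
      gaussNormFun r h < gaussNormFun r (AddMonoidAlgebra.single q a : PerfPoly p K n) := by
  obtain ⟨f, h, hgf, hf, hlt, htop⟩ := exists_top_part r hg
  have hne : f.coeff.support.Nonempty := by
    rwa [Finsupp.support_nonempty_iff, ne_eq, AddMonoidAlgebra.coeff_eq_zero]
  obtain ⟨q, hq⟩ := hne
  have hq0 := Finsupp.mem_support_iff.1 hq
  have hfs : f = AddMonoidAlgebra.single q (f.coeff q) := by
    refine AddMonoidAlgebra.coeff_injective (Finsupp.ext fun q' => ?_)
    rw [AddMonoidAlgebra.coeff_single]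
    by_cases h' : q' = q
    · rw [h', Finsupp.single_eq_same]
    · rw [Finsupp.single_eq_of_ne h']
      by_contra h0
      exact h' (hr.monomial_injective h0 hq0
        ((htop q' (Finsupp.mem_support_iff.2 h0)).trans (htop q hq).symm))
  refine ⟨q, f.coeff q, h, hq0, by rw [← hfs, ← hgf], ?_⟩
  rw [gaussNormFun_single, htop q hq]
  exact hlt

lemma gaussNormFun_algebraMap (r : Polyradius n) (a : K) :
    gaussNormFun r (algebraMap K (PerfPoly p K n) a) = ‖a‖₊ :=
  (gaussNormFun_single r 0 a).trans (by rw [monomialNorm_zero, mul_one])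

end Monomial

section Density

variable {p : ℕ} {K : Type*} [NormedField K] {n : ℕ}

/-- The product `x₁ ⋯ xₙ`. -/
def prodVars (p : ℕ) (K : Type*) [NormedField K] (n : ℕ) : PerfPoly p K n :=
  AddMonoidAlgebra.single (fun _ => PExp.ofNat p 1) 1

lemma prodVars_pow (b : ℕ) :
    prodVars p K n ^ b = AddMonoidAlgebra.single (fun _ => PExp.ofNat p b) 1 := by
  rw [prodVars, AddMonoidAlgebra.single_pow, one_pow]
  congr 1
  funext i
  refine Subtype.ext ?_
  rw [Pi.smul_apply, AddSubmonoidClass.coe_nsmul, PExp.coe_ofNat, PExp.coe_ofNat]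
  simp

lemma prodVars_ne_zero : prodVars p K n ≠ 0 :=
  AddMonoidAlgebra.single_ne_zero.2 one_ne_zero

section Ring

variable {L : Type*} [NormedField L]

/-- The image of the ring of Laurent polynomials in a field to which `K[x₁^{1/p^∞}, …]` maps
injectively. -/
def laurentSubring (ι : PerfPoly p K n →+* L) (hP : ι (prodVars p K n) ≠ 0) : Subring L where
  carrier := {z | ∃ (f : PerfPoly p K n) (b : ℕ), z = ι f / ι (prodVars p K n) ^ b}
  mul_mem' := by
    rintro _ _ ⟨f, b, rfl⟩ ⟨f', b', rfl⟩
    exact ⟨f * f', b + b', by rw [map_mul, pow_add, div_mul_div_comm]⟩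
  one_mem' := ⟨1, 0, by simp⟩
  add_mem' := by
    rintro _ _ ⟨f, b, rfl⟩ ⟨f', b', rfl⟩
    refine ⟨f * prodVars p K n ^ b' + f' * prodVars p K n ^ b, b + b', ?_⟩
    rw [div_add_div _ _ (pow_ne_zero _ hP) (pow_ne_zero _ hP), map_add, map_mul, map_mul, map_pow,
      map_pow, pow_add, mul_comm (ι f')]
  zero_mem' := ⟨0, 0, by simp⟩
  neg_mem' := by
    rintro _ ⟨f, b, rfl⟩
    exact ⟨-f, b, by rw [map_neg, neg_div]⟩

/-- The inverse is the sum of the geometric series in `-u`, whose partial sums lie in `S`. -/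
lemma inv_one_add_mem_closure [CompleteSpace L] (S : Subring L) {u : L}
    (hu : u ∈ S) (hu1 : ‖u‖ < 1) : (1 + u)⁻¹ ∈ S.topologicalClosure := by
  have h := (hasSum_geometric_of_norm_lt_one (ξ := -u) (by rwa [norm_neg])).tendsto_sum_nat
  rw [sub_neg_eq_add] at h
  exact mem_closure_of_tendsto h (Filter.Eventually.of_forall fun n =>
    S.sum_mem fun i _ => S.pow_mem (S.neg_mem hu) i)

lemma map_ne_zero_of_nnnorm_eq {r : Polyradius n} {ι : PerfPoly p K n →+* L}
    (hι : ∀ f, ‖ι f‖₊ = gaussNormFun r f) {f : PerfPoly p K n} (hf : f ≠ 0) : ι f ≠ 0 := by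
  rw [← nnnorm_ne_zero_iff, hι, ne_eq, gaussNormFun_eq_zero]
  exact hf

/-- For a free polyradius, quotients of polynomials are limits of Laurent polynomials. -/
lemma IsFreePolyradius.div_mem_closure [IsUltrametricDist K] [CompleteSpace L]
    [hp : Fact p.Prime] {r : Polyradius n} (hr : IsFreePolyradius K r)
    {ι : PerfPoly p K n →+* L} (hι : ∀ f, ‖ι f‖₊ = gaussNormFun r f)
    (f : PerfPoly p K n) {g : PerfPoly p K n} (hg : g ≠ 0) :
    ι f / ι g ∈ (laurentSubring ι
      (map_ne_zero_of_nnnorm_eq hι prodVars_ne_zero)).topologicalClosure := by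
  set S := laurentSubring ι (map_ne_zero_of_nnnorm_eq hι prodVars_ne_zero) with hS
  have hpoly : ∀ f b, ι f / ι (prodVars p K n) ^ b ∈ S := fun f b => ⟨f, b, rfl⟩
  obtain ⟨q, a, h, ha, rfl, hlt⟩ := hr.exists_dominant hg
  obtain ⟨B, s, hs⟩ := PExp.exists_add_eq_ofNat q
  set m : PerfPoly p K n := AddMonoidAlgebra.single q a
  -- `G / P ^ B` is the inverse of the dominant monomial `m`, so `1 / (m + h)` becomes this inverse
  -- times a geometric series in `h / m`.
  set G : PerfPoly p K n := AddMonoidAlgebra.single s a⁻¹ with hG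
  have hGm : ι G * ι m = ι (prodVars p K n) ^ B := by
    rw [← map_mul, ← map_pow, prodVars_pow, hG, AddMonoidAlgebra.single_mul_single, hs,
      inv_mul_cancel₀ ha]
  have hm : ι m ≠ 0 := map_ne_zero_of_nnnorm_eq hι (AddMonoidAlgebra.single_ne_zero.2 ha)
  have hG0 : ι G ≠ 0 :=
    map_ne_zero_of_nnnorm_eq hι (AddMonoidAlgebra.single_ne_zero.2 (inv_ne_zero ha))
  have hu : ι (h * G) / ι (prodVars p K n) ^ B = ι h / ι m := by
    rw [← hGm, map_mul]
    field_simp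
  have hu1 : ‖ι (h * G) / ι (prodVars p K n) ^ B‖₊ < 1 := by
    rw [hu, nnnorm_div, hι, hι]
    exact (div_lt_one₀ (zero_le.trans_lt hlt)).2 hlt
  have h1 := inv_one_add_mem_closure S (hpoly (h * G) B) hu1
  have h2 : ι f / ι (m + h) = (ι (f * G) / ι (prodVars p K n) ^ B) *
      (1 + ι (h * G) / ι (prodVars p K n) ^ B)⁻¹ := by
    rw [hu, ← hGm, map_add, map_mul, one_add_div hm]
    field_simp
  rw [h2]
  exact mul_mem (S.le_topologicalClosure (hpoly _ _)) h1

end Ring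

/-- For a free polyradius, the Laurent polynomials are dense in `K_r^perfd`. -/
lemma IsFreePolyradius.exists_laurent_approx [IsUltrametricDist K] [hp : Fact p.Prime]
    {r : Polyradius n} (hr : IsFreePolyradius K r)
    (z : PerfdGaussField p K r) {ε : ℝ} (hε : 0 < ε) :
    ∃ (f : PerfPoly p K n) (b : ℕ), ‖z - gaussIncl r f / gaussIncl r (prodVars p K n) ^ b‖ < ε := by
  have hι : ∀ f : PerfPoly p K n, ‖(gaussIncl r).toRingHom f‖₊ = gaussNormFun r f := nnnorm_gaussIncl r
  have hz := dense_gaussIncl_div r z (Subring.isClosed_topologicalClosure _)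
    fun f g hg => hr.div_mem_closure hι f hg
  obtain ⟨_, ⟨f, b, rfl⟩, hfb⟩ := Metric.mem_closure_iff.1 hz ε hε
  exact ⟨f, b, by rw [dist_eq_norm] at hfb; exact hfb⟩

end Density

/-! ### Extension to the perfectoid Tate algebra -/

section Tate

variable {p : ℕ} {K : Type*} [NormedField K] [IsUltrametricDist K] {N : ℕ}

/-- A bounded homomorphism from `K[T₁^{1/p^∞}, …]` to a complete field which hits every element up
to a fixed relative error, by elements of controlled norm, extends to an open quotient map from the
perfectoid Tate algebra. -/
lemma exists_isOpenQuotientMap_of_approx {L : Type*} [NormedField L] [CompleteSpace L] [Algebra K L]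
    (φ : PerfPoly p K N →ₐ[K] L)
    (hφ : ∀ f, ‖φ f‖₊ ≤ gaussNormFun (fun _ => ⟨1, one_pos⟩) f) {C e : ℝ≥0} (he : e < 1)
    (h : ∀ z : L, ∃ f : PerfPoly p K N, gaussNormFun (fun _ => ⟨1, one_pos⟩) f ≤ C * ‖z‖₊ ∧
      ‖φ f - z‖₊ ≤ e * ‖z‖₊) :
    ∃ Φ : PerfdTateAlgebra p K N →ₐ[K] L, IsOpenQuotientMap Φ := by
  let v : AbsoluteValue (PerfPoly p K N) ℝ := gaussAbs p K (fun _ => ⟨1, one_pos⟩)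
  let ψ : WithAbs v →+* L := φ.toRingHom.comp (WithAbs.equiv v).toRingHom
  have hψ : ∀ f : WithAbs v, ‖ψ f‖ ≤ 1 * ‖f‖ := fun f => by
    rw [one_mul]
    exact hφ f.ofAbs
  have hc : Continuous ψ := AddMonoidHomClass.continuous_of_bound ψ 1 hψ
  let Φ : PerfdTateAlgebra p K N →ₐ[K] L :=
    { UniformSpace.Completion.extensionHom ψ hc with
      commutes' := fun a => by
        change UniformSpace.Completion.extensionHom ψ hc _ = _
        rw [UniformSpace.Completion.algebraMap_def, UniformSpace.Completion.extensionHom_coe]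
        exact φ.commutes a }
  have hΦ : ∀ f : WithAbs v, Φ (f : PerfdTateAlgebra p K N) = φ f.ofAbs := fun f =>
    UniformSpace.Completion.extensionHom_coe ψ hc f
  have hΦc : Continuous Φ := UniformSpace.Completion.continuous_extension
  refine ⟨Φ, isOpenQuotientMap_of_approx (C := C) (e := e) (Φ : PerfdTateAlgebra p K N →+ L) hΦc
    C.2 e.2 (by exact_mod_cast he) fun z => ?_⟩
  obtain ⟨f, hf, hfz⟩ := h z
  refine ⟨((WithAbs.toAbs v f : WithAbs v) : PerfdTateAlgebra p K N), ?_, ?_⟩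
  · rw [UniformSpace.Completion.norm_coe]
    exact hf
  · have := hΦ (WithAbs.toAbs v f)
    change ‖Φ _ - z‖ ≤ _
    rw [this]
    exact hfz

end Tate

/-! ### The main construction -/

section Main

variable {p : ℕ} [hp : Fact p.Prime] {K : Type*} [NormedField K] {l : ℕ}

/-- The monomials `x ^ (s / p ^ m)`. -/
def rootMonomial (K : Type*) [NormedField K] (s : Fin l → PExp p) (m : ℕ) : PerfPoly p K l :=
  AddMonoidAlgebra.single (fun i => PExp.divPow m (s i)) 1

lemma isRootSystem_rootMonomial (s : Fin l → PExp p) : IsRootSystem p (rootMonomial K s) := by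
  intro m
  rw [rootMonomial, AddMonoidAlgebra.single_pow, one_pow]
  congr 1
  funext i
  exact PExp.nsmul_divPow_succ m (s i)

lemma rootMonomial_zero (s : Fin l → PExp p) :
    rootMonomial K s 0 = AddMonoidAlgebra.single s 1 := by
  simp only [rootMonomial, PExp.divPow_zero]

lemma rootPow_map_rootMonomial {L : Type*} [NormedField L] [Algebra K L]
    (ι : PerfPoly p K l →ₐ[K] L) (i : Fin l) (q : PExp p) :
    rootPow (fun m => ι (rootMonomial K (Pi.single i (PExp.ofNat p 1)) m)) q =
      ι (AddMonoidAlgebra.single (Pi.single i q) 1) := by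
  obtain ⟨k, n, h⟩ := q.2
  rw [rootPow_eq ((isRootSystem_rootMonomial _).map ι) h, ← map_pow, rootMonomial,
    AddMonoidAlgebra.single_pow, one_pow]
  congr 2
  funext j
  have hpk : (p : ℚ≥0) ^ k ≠ 0 := pow_ne_zero _ (Nat.cast_ne_zero.2 hp.out.ne_zero)
  refine Subtype.ext ?_
  rw [Pi.smul_apply, AddSubmonoidClass.coe_nsmul, PExp.coe_divPow]
  by_cases hj : j = i
  · subst hj
    rw [Pi.single_eq_same, Pi.single_eq_same, PExp.coe_ofNat, nsmul_eq_mul, ← h]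
    field_simp
    simp
  · rw [Pi.single_eq_of_ne hj, Pi.single_eq_of_ne hj]
    simp

lemma prod_rootPow_map_rootMonomial {L : Type*} [NormedField L] [Algebra K L]
    (ι : PerfPoly p K l →ₐ[K] L) (q : Fin l → PExp p) :
    ∏ i, rootPow (fun m => ι (rootMonomial K (Pi.single i (PExp.ofNat p 1)) m)) (q i) =
      ι (AddMonoidAlgebra.single q 1) := by
  simp_rw [rootPow_map_rootMonomial]
  rw [← map_prod]
  congr 1
  have := map_prod (AddMonoidAlgebra.of K (Fin l → PExp p))
    (fun i => Multiplicative.ofAdd (Pi.single i (q i) : Fin l → PExp p)) Finset.univ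
  rw [← ofAdd_sum, Finset.univ_sum_single] at this
  exact this.symm

variable [IsUltrametricDist K] {r : Polyradius l} {L : Type*} [NormedField L] [IsUltrametricDist L]
  [CompleteSpace L] [Algebra K L]

/-- Every positive number has a multiple by a power of `ρ` in `(ρ ^ 3, ρ ^ 2]`. -/
lemma exists_zpow_mul_mem {ρ : ℝ≥0} (hρ0 : 0 < ρ) (hρ1 : ρ < 1) {t : ℝ≥0} (ht : 0 < t) :
    ∃ e : ℤ, ρ ^ 3 < ρ ^ e * t ∧ ρ ^ e * t ≤ ρ ^ 2 := by
  obtain ⟨k, hk1, hk2⟩ := exists_mem_Ioc_zpow (x := t) (y := ρ⁻¹) ht ((one_lt_inv₀ hρ0).2 hρ1)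
  rw [inv_zpow'] at hk1 hk2
  refine ⟨k + 3, ?_, ?_⟩
  · calc ρ ^ 3 = ρ ^ (k + 3) * ρ ^ (-k) := by
          rw [← zpow_add₀ hρ0.ne', ← zpow_natCast]; congr 1; push_cast; ring
      _ < _ := by gcongr
  · calc _ ≤ ρ ^ (k + 3) * ρ ^ (-(k + 1)) := by gcongr
      _ = ρ ^ 2 := by
          rw [← zpow_add₀ hρ0.ne', ← zpow_natCast]; congr 1; push_cast; ring

/-- The main construction: a homomorphism `K[T₁^{1/p^∞}, …, T_N^{1/p^∞}] → L`, for `N > l`, with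
good approximation properties, where `L` is a completion of `K(x₁^{1/p^∞}, …, x_l^{1/p^∞})`. -/
theorem exists_evalRoots_approx (hL : ∀ a : K, ‖algebraMap K L a‖₊ = ‖a‖₊)
    {π : ℕ → K} (hπ : IsRootSystem p π) {ρ : ℝ≥0} (hπρ : ‖π 0‖₊ = ρ) (hρ0 : 0 < ρ) (hρ1 : ρ < 1)
    (hpρ : ‖(p : K)‖₊ ≤ ρ ^ 4) (ι : PerfPoly p K l →ₐ[K] L)
    (hι : ∀ f, ‖ι f‖₊ = gaussNormFun r f) (hr : ∀ i, (r i : ℝ≥0) ≤ 1)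
    (d : ℕ) :
    ∃ (φ : PerfPoly p K (l + (d + 1)) →ₐ[K] L) (C : ℝ≥0),
      (∀ f, ‖φ f‖₊ ≤ gaussNormFun (fun _ => ⟨1, one_pos⟩) f) ∧
      ∀ (s : Fin l → PExp p) (b : ℕ), ∃ (e : ℤ) (g : PerfPoly p K (l + (d + 1))),
        gaussNormFun (fun _ => ⟨1, one_pos⟩) g ≤ C ∧
        ρ ^ 3 < ‖algebraMap K L (π 0 ^ e) * ι (AddMonoidAlgebra.single s 1) /
          ι (prodVars p K l) ^ b‖₊ ∧
        ‖φ g - algebraMap K L (π 0 ^ e) * ι (AddMonoidAlgebra.single s 1) /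
          ι (prodVars p K l) ^ b‖₊ ≤ ρ ^ 4 := by
  have hprod : rootMonomial K (fun _ : Fin l => PExp.ofNat p 1) 0 = prodVars p K l :=
    rootMonomial_zero _
  set x : (Fin l → PExp p) → ℕ → L := fun s m => ι (rootMonomial K s m) with hx
  set P : ℕ → L := x fun _ => PExp.ofNat p 1 with hPdef
  have hP0 : ι (prodVars p K l) = P 0 := by rw [← hprod]
  have hxroot : ∀ s, IsRootSystem p (x s) := fun s => (isRootSystem_rootMonomial s).map ι
  have hxne : ∀ s m, x s m ≠ 0 := fun s m =>
    map_ne_zero_of_nnnorm_eq (ι := ι.toRingHom) hι (AddMonoidAlgebra.single_ne_zero.2 one_ne_zero)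
  have hxpos : ∀ s m, 0 < ‖x s m‖₊ := fun s m => nnnorm_pos.2 (hxne s m)
  have hx1 : ∀ s, ‖x s 0‖₊ ≤ 1 := by
    intro s
    rw [hx]
    simp only
    rw [hι, rootMonomial_zero, gaussNormFun_single, nnnorm_one, one_mul]
    exact Finset.prod_le_one' fun i _ => NNReal.rpow_le_one (hr i) (by positivity)
  have hπL : ∀ n : ℤ, IsRootSystem p fun m => algebraMap K L (π m ^ n) := fun n =>
    (hπ.zpow n).map (algebraMap K L)
  -- This makes `π ^ M * E / P` integral, so that it is an admissible value for a variable.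
  obtain ⟨M, hM⟩ : ∃ M, ρ ^ M < ‖P 0‖₊ := exists_pow_lt_of_lt_one (hxpos _ 0) hρ1
  -- enumerate the Laurent monomials
  obtain ⟨J, hJ⟩ := exists_surjective_nat ((Fin l → PExp p) × ℕ)
  -- The upper bound `ρ ^ 2` is what the construction of `E` needs; the lower bound `ρ ^ 3` turns
  -- the later error `ρ ^ 4` into a relative error below `ρ`.
  have hnorm : ∀ j, ∃ e : ℤ, ρ ^ 3 < ‖algebraMap K L (π 0 ^ e) * x (J j).1 0 / P 0 ^ (J j).2‖₊ ∧
      ‖algebraMap K L (π 0 ^ e) * x (J j).1 0 / P 0 ^ (J j).2‖₊ ≤ ρ ^ 2 := by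
    intro j
    obtain ⟨e, he⟩ := exists_zpow_mul_mem hρ0 hρ1
      (t := ‖x (J j).1 0‖₊ / ‖P 0‖₊ ^ (J j).2) (div_pos (hxpos _ _) (pow_pos (hxpos _ _) _))
    refine ⟨e, ?_⟩
    rw [nnnorm_div, nnnorm_mul, hL, nnnorm_zpow, hπρ, nnnorm_pow, mul_div_assoc]
    exact he
  choose e he3 he2 using hnorm
  set τ : ℕ → ℕ → L := fun j m => algebraMap K L (π m ^ e j) * x (J j).1 m / P m ^ (J j).2 with hτ
  have hτroot : ∀ j, IsRootSystem p (τ j) := by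
    intro j
    have := ((hπL (e j)).mul (hxroot (J j).1)).mul ((hxroot fun _ => PExp.ofNat p 1).pow (J j).2).inv
    intro m
    have h := this m
    simp only [Pi.mul_apply, Pi.inv_apply, Pi.pow_apply, ← div_eq_mul_inv] at h
    exact h
  have hτ1 : ∀ j m, ‖τ j m‖₊ ≤ 1 := fun j =>
    (hτroot j).nnnorm_le_one ((he2 j).trans (pow_le_one' hρ1.le 2))
  -- Each gap is large enough for the exponents of the preceding monomial; the `+ 1` makes `κ`
  -- strictly increasing.
  set κ : ℕ → ℕ := fun j => ∑ i ∈ Finset.range j, ((e i).natAbs + (J i).2 * M + 1) with hκdef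
  have hκs : ∀ j, κ (j + 1) = κ j + ((e j).natAbs + (J j).2 * M + 1) := fun j =>
    Finset.sum_range_succ _ _
  have hκ : StrictMono κ := strictMono_nat_of_lt_succ fun j => by rw [hκs]; omega
  have hκ' : ∀ i j, i < j → (e i).natAbs + (J i).2 * M ≤ κ j - κ i := by
    intro i j hij
    have h1 := hκ.monotone (Nat.succ_le_of_lt hij)
    have h2 := hκs i
    simp only [Nat.succ_eq_add_one] at h1
    omega
  have hpL : ‖(p : L)‖₊ ≤ ρ ^ 4 := by rwa [← map_natCast (algebraMap K L), hL]
  obtain ⟨E, hEroot, hE, hE'⟩ := exists_isRootSystem_one_add_sum hρ1 hpL hτroot he2 hκ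
  -- the system of roots for the remaining variables
  set w : ℕ → L := fun m => algebraMap K L (π m ^ M) * E m / P m with hw
  have hwroot : IsRootSystem p w := by
    have := ((hπL M).mul hEroot).mul (hxroot fun _ => PExp.ofNat p 1).inv
    intro m
    have h := this m
    simp only [Pi.mul_apply, Pi.inv_apply, ← div_eq_mul_inv, zpow_natCast] at h
    exact h
  have hE0 : ‖E 0‖₊ ≤ 1 := by
    have h1 := hE 0
    rw [pow_zero, pow_one] at h1
    have h2 := IsUltrametricDist.nnnorm_add_le_max (E 0 - 1) 1
    rw [sub_add_cancel, nnnorm_one] at h2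
    exact h2.trans (max_le (h1.trans (pow_le_one' hρ1.le 2)) le_rfl)
  have hw0 : ‖w 0‖₊ ≤ 1 := by
    simp only [hw]
    rw [nnnorm_div, nnnorm_mul, hL, nnnorm_pow, hπρ]
    refine div_le_one_of_le₀ ?_ zero_le
    calc _ ≤ ρ ^ M * 1 := by gcongr
      _ ≤ _ := by rw [mul_one]; exact hM.le
  -- All `d + 1` further variables go to `w`; only the first of them is used for preimages.
  set R : Fin (l + (d + 1)) → ℕ → L :=
    Fin.append (fun i => x (Pi.single i (PExp.ofNat p 1))) (fun _ => w) with hR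
  have hRroot : ∀ i, IsRootSystem p (R i) := by
    intro i
    refine Fin.addCases (fun i => ?_) (fun i => ?_) i
    · rw [hR, Fin.append_left]; exact hxroot _
    · rw [hR, Fin.append_right]; exact hwroot
  have hR1 : ∀ i, ‖R i 0‖₊ ≤ 1 := by
    intro i
    refine Fin.addCases (fun i => ?_) (fun i => ?_) i
    · rw [hR, Fin.append_left]; exact hx1 _
    · rw [hR, Fin.append_right]; exact hw0
  set φ := evalRoots K R hRroot with hφ
  -- preimages of the monomials
  let T : (Fin l → PExp p) → ℕ → PerfPoly p K (l + (d + 1)) := fun s m =>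
    AddMonoidAlgebra.single (Fin.append (fun i => PExp.divPow m (s i)) 0) 1
  let W : ℕ → PerfPoly p K (l + (d + 1)) := fun m =>
    AddMonoidAlgebra.single (Pi.single (Fin.natAdd l 0) (PExp.divPow m (PExp.ofNat p 1))) 1
  have hsingle : ∀ q : Fin (l + (d + 1)) → PExp p, gaussValuation p K (fun _ => ⟨1, one_pos⟩)
      (AddMonoidAlgebra.single q 1) ≤ 1 := by
    intro q
    refine (gaussNormFun_single _ q (1 : K)).trans_le ?_
    simp [monomialNorm]
  have hφT : ∀ s m, φ (T s m) = x s m := by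
    intro s m
    rw [hφ, evalRoots_single, map_one, one_mul, Fin.prod_univ_add]
    simp only [hR, Fin.append_left, Fin.append_right, Pi.zero_apply, rootPow_zero hwroot,
      Finset.prod_const_one, mul_one]
    exact prod_rootPow_map_rootMonomial ι _
  have hφW : ∀ m, φ (W m) = w m := by
    intro m
    rw [hφ, evalRoots_single_single, hR, Fin.append_right, rootPow_divPow_one hwroot]
  refine ⟨φ, ρ⁻¹ ^ (2 + 2 * M), nnnorm_evalRoots_le hL R hRroot hR1, fun s b => ?_⟩
  obtain ⟨j, hj⟩ := hJ (s, b)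
  obtain ⟨g, hg, hg'⟩ := exists_approx_of_root_systems (φ := φ)
    (v := gaussValuation p K (fun _ => ⟨1, one_pos⟩)) (gaussNormFun_algebraMap _) hπ hπρ hρ0 hρ1
    (x := fun j => x (J j).1) (P := P) (fun m => hxne _ m) (fun j m => rfl) hτ1 hκ' hE hE'
    (S := fun j => T (J j).1) (D := T fun _ => PExp.ofNat p 1) (W := W) (fun _ _ => hsingle _)
    (fun _ => hsingle _) (fun _ => hsingle _) (fun _ _ => hφT _ _) (fun _ => hφT _ _) hφW j
  have hτ0 : τ j 0 = algebraMap K L (π 0 ^ e j) * ι (AddMonoidAlgebra.single s 1) /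
      ι (prodVars p K l) ^ b := by
    rw [hP0, ← rootMonomial_zero]
    simp only [τ, hj, hx]
  refine ⟨e j, g, hg, ?_, ?_⟩
  · rw [← hτ0]; exact he3 j
  · rw [← hτ0]; exact hg'

/-- The perfectoid Tate algebra in more than `l` variables maps onto a completion of
`K(x₁^{1/p^∞}, …, x_l^{1/p^∞})` in which the Laurent polynomials are dense. -/
theorem exists_isOpenQuotientMap_of_dense (hL : ∀ a : K, ‖algebraMap K L a‖₊ = ‖a‖₊)
    {π : ℕ → K} (hπ : IsRootSystem p π) {ρ : ℝ≥0} (hπρ : ‖π 0‖₊ = ρ) (hρ0 : 0 < ρ) (hρ1 : ρ < 1)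
    (hpρ : ‖(p : K)‖₊ ≤ ρ ^ 4) (ι : PerfPoly p K l →ₐ[K] L)
    (hι : ∀ f, ‖ι f‖₊ = gaussNormFun r f) (hr : ∀ i, (r i : ℝ≥0) ≤ 1)
    (hdense : ∀ (z : L) (ε : ℝ), 0 < ε → ∃ (f : PerfPoly p K l) (b : ℕ),
      ‖z - ι f / ι (prodVars p K l) ^ b‖ < ε) {N : ℕ} (hN : l < N) :
    ∃ Φ : PerfdTateAlgebra p K N →ₐ[K] L, IsOpenQuotientMap Φ := by
  obtain ⟨d, rfl⟩ := Nat.exists_eq_add_of_lt hN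
  rw [add_assoc]
  obtain ⟨φ, C, hφ, happ⟩ :=
    exists_evalRoots_approx hL hπ hπρ hρ0 hρ1 hpρ ι hι hr d
  -- The relative error is `ρ = ρ ^ 4 / ρ ^ 3`; the factor `(ρ ^ 3)⁻¹` pays for rescaling the
  -- normalized monomials.
  refine exists_isOpenQuotientMap_of_approx φ hφ (C := C * (ρ ^ 3)⁻¹) hρ1 fun z => ?_
  by_cases hz : z = 0
  · exact ⟨0, by simp [hz, gaussNormFun], by simp [hz]⟩
  have hzpos : 0 < ‖z‖ := norm_pos_iff.2 hz
  have hρ0' : (0 : ℝ) < ρ := hρ0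
  obtain ⟨f, b, hfb⟩ := hdense z (ρ * ‖z‖) (by positivity)
  have hfb' : ‖z - ι f / ι (prodVars p K l) ^ b‖₊ ≤ ρ * ‖z‖₊ := hfb.le
  set P := ι (prodVars p K l) with hP
  have hfz : ‖ι f / P ^ b‖₊ ≤ ‖z‖₊ := by
    have h1 := IsUltrametricDist.nnnorm_add_le_max (-(z - ι f / P ^ b)) z
    rw [nnnorm_neg, neg_sub, sub_add_cancel] at h1
    refine h1.trans (max_le (hfb'.trans (mul_le_of_le_one_left zero_le hρ1.le)) le_rfl)
  -- each term of `f`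
  have hterm : ∀ s : Fin l → PExp p, ∃ g : PerfPoly p K (l + (d + 1)),
      gaussNormFun (fun _ => ⟨1, one_pos⟩) g ≤ C * (ρ ^ 3)⁻¹ * ‖z‖₊ ∧
      ‖φ g - algebraMap K L (f.coeff s) * ι (AddMonoidAlgebra.single s 1) / P ^ b‖₊ ≤
        ρ * ‖z‖₊ := by
    intro s
    obtain ⟨e, g, hg, he, hge⟩ := happ s b
    set t := algebraMap K L (π 0 ^ e) * ι (AddMonoidAlgebra.single s 1) / P ^ b with ht
    have hπ0 : π 0 ≠ 0 := by
      rintro h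
      rw [h, nnnorm_zero] at hπρ
      exact hρ0.ne hπρ
    set a : K := f.coeff s * (π 0 ^ e)⁻¹ with ha
    have hat : algebraMap K L (f.coeff s) * ι (AddMonoidAlgebra.single s 1) / P ^ b =
        algebraMap K L a * t := by
      have h0 : algebraMap K L (π 0 ^ e) ≠ 0 := by
        rw [ne_eq, FaithfulSMul.algebraMap_eq_zero_iff]
        exact zpow_ne_zero _ hπ0
      rw [ht, ha, map_mul, map_inv₀]
      field_simp
    -- No single term of `f` exceeds `f` in norm, because the norm restricts to the Gauss norm on
    -- polynomials.
    have hale : ‖a‖₊ ≤ (ρ ^ 3)⁻¹ * ‖z‖₊ := by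
      rw [← div_eq_inv_mul, le_div_iff₀ (pow_pos hρ0 3)]
      calc ‖a‖₊ * ρ ^ 3 ≤ ‖a‖₊ * ‖t‖₊ := by gcongr
        _ = ‖algebraMap K L (f.coeff s) * ι (AddMonoidAlgebra.single s 1) / P ^ b‖₊ := by
          rw [hat, nnnorm_mul (algebraMap K L a), hL]
        _ ≤ ‖ι f / P ^ b‖₊ := by
          rw [nnnorm_div, nnnorm_div, nnnorm_mul, hL, hι, hι, gaussNormFun_single, nnnorm_one,
            one_mul]
          gcongr
          exact le_gaussNormFun r f s
        _ ≤ ‖z‖₊ := hfz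
    refine ⟨algebraMap K _ a * g, ?_, ?_⟩
    · rw [gaussNormFun_mul, gaussNormFun_algebraMap]
      calc _ ≤ ((ρ ^ 3)⁻¹ * ‖z‖₊) * C := by gcongr
        _ = _ := by ring
    · rw [hat, map_mul, AlgHom.commutes, ← mul_sub, nnnorm_mul, hL]
      calc _ ≤ ((ρ ^ 3)⁻¹ * ‖z‖₊) * ρ ^ 4 := by gcongr
        _ = _ := by field_simp
  choose g hg hg' using hterm
  have hfsum : ι f / P ^ b = ∑ s ∈ f.coeff.support,
      algebraMap K L (f.coeff s) * ι (AddMonoidAlgebra.single s 1) / P ^ b := by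
    rw [← Finset.sum_div]
    congr 1
    have : f = ∑ s ∈ f.coeff.support,
        algebraMap K (PerfPoly p K l) (f.coeff s) * AddMonoidAlgebra.single s 1 := by
      refine AddMonoidAlgebra.coeff_injective ?_
      conv_lhs => rw [← Finsupp.sum_single f.coeff]
      rw [Finsupp.sum, AddMonoidAlgebra.coeff_sum]
      refine Finset.sum_congr rfl fun s _ => ?_
      rw [← Algebra.smul_def, AddMonoidAlgebra.smul_single, smul_eq_mul, mul_one,
        AddMonoidAlgebra.coeff_single]
    conv_lhs => rw [this]
    rw [map_sum]
    simp only [map_mul, AlgHom.commutes]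
  refine ⟨∑ s ∈ f.coeff.support, g s, ?_, ?_⟩
  · exact (gaussValuation p K (fun _ => ⟨1, one_pos⟩)).map_sum_le fun s _ => hg s
  · have : φ (∑ s ∈ f.coeff.support, g s) - z = ∑ s ∈ f.coeff.support, (φ (g s) -
        algebraMap K L (f.coeff s) * ι (AddMonoidAlgebra.single s 1) / P ^ b) +
        -(z - ι f / P ^ b) := by
      rw [Finset.sum_sub_distrib, ← hfsum, map_sum]
      ring
    rw [this]
    refine (IsUltrametricDist.nnnorm_add_le_max _ _).trans (max_le ?_ (by rwa [nnnorm_neg]))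
    exact IsUltrametricDist.nnnorm_sum_le_of_forall_le fun s _ => hg' s

end Main

/-! ### Quotient fields of perfectoid Tate algebras -/

/-- For a `K`-free polyradius `r ∈ (0, 1]^l`, the field `K_r^perfd` is a quotient of the perfectoid
Tate algebra in any number `N > l` of variables. -/
theorem exists_isOpenQuotientMap_perfdGaussField {p : ℕ} [Fact p.Prime] {K : Type*}
    [NontriviallyNormedField K] [IsUltrametricDist K] (hK : IsPerfectoidField p K) {l : ℕ}
    {r : Polyradius l} (hr1 : ∀ i, (r i : ℝ≥0) ≤ 1) (hr : IsFreePolyradius K r) {N : ℕ}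
    (hN : l < N) :
    ∃ φ : PerfdTateAlgebra p K N →ₐ[K] PerfdGaussField p K r, IsOpenQuotientMap φ := by
  obtain ⟨π, hπ, hπ0, hπ1, hpπ⟩ := hK.exists_isRootSystem
  exact exists_isOpenQuotientMap_of_dense (nnnorm_algebraMap_gaussField r) hπ rfl hπ0 hπ1 hpπ
    (gaussIncl r) (nnnorm_gaussIncl r) hr1 (fun z _ hε => hr.exists_laurent_approx z hε) hN

/-- A quotient field `E` of `A` is, as the top intermediate field, a quotient of `A`. -/
lemma exists_intermediateField_of_isOpenQuotientMap {F A E : Type*} [Field F] [Field E]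
    [TopologicalSpace E] [Algebra F E] [Ring A] [TopologicalSpace A] [Algebra F A] (φ : A →ₐ[F] E)
    (hφ : IsOpenQuotientMap φ) :
    ∃ K' : IntermediateField F E, FiniteDimensional K' E ∧ Algebra.IsSeparable K' E ∧
      ∃ ψ : A →ₐ[F] K', IsOpenQuotientMap ψ := by
  let h : E ≃ₜ (⊤ : IntermediateField F E) :=
    { toFun := fun z => ⟨z, IntermediateField.mem_top⟩
      invFun := fun z => z
      left_inv := fun _ => rfl
      right_inv := fun _ => rfl
      continuous_toFun := Continuous.subtype_mk continuous_id _
      continuous_invFun := continuous_subtype_val }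
  refine ⟨⊤, ?_, ⟨fun z => ?_⟩,
    (IntermediateField.topEquiv (F := F) (E := E)).symm.toAlgHom.comp φ,
    h.isOpenQuotientMap.comp hφ⟩
  · exact .of_surjective (Algebra.linearMap (⊤ : IntermediateField F E) E)
      fun z => ⟨⟨z, IntermediateField.mem_top⟩, rfl⟩
  · exact isSeparable_algebraMap (⟨z, IntermediateField.mem_top⟩ : (⊤ : IntermediateField F E))

end

theorem mainTheorem4 (p : ℕ) [Fact p.Prime] (K : Type*) [NontriviallyNormedField K]
    [IsUltrametricDist K] (hK : IsPerfectoidField p K) (n : ℕ) (hn : 1 ≤ n) :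
    (∀ l : ℕ, l ≤ n → ∀ r : Polyradius l, (∀ i, (r i : ℝ≥0) ≤ 1) → IsFreePolyradius K r →
      ∃ φ : PerfdTateAlgebra p K (n + 2) →ₐ[K] PerfdGaussField p K r,
        IsOpenQuotientMap φ) ∧
    (∀ r : Polyradius n, (∀ i, (r i : ℝ≥0) ≤ 1) → IsFreePolyradius K r →
      ∃ K' : IntermediateField K (PerfdGaussField p K r),
        FiniteDimensional K' (PerfdGaussField p K r) ∧
        Algebra.IsSeparable K' (PerfdGaussField p K r) ∧
        ∃ φ : PerfdTateAlgebra p K (n + 1) →ₐ[K] K', IsOpenQuotientMap φ) := by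
  refine ⟨fun l hl r hr1 hr => exists_isOpenQuotientMap_perfdGaussField hK hr1 hr (by omega),
    fun r hr1 hr => ?_⟩
  obtain ⟨φ, hφ⟩ :=
    exists_isOpenQuotientMap_perfdGaussField (N := n + 1) hK hr1 hr (Nat.lt_succ_self n)
  exact exists_intermediateField_of_isOpenQuotientMap φ hφ
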